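/- Let $\Bbbk$ be a field of characteristic $0$ and $s\ge 0$. Choose $s$ distinct marked points $x_1,\dots,x_s$ on a graph $X$ of rank one, which we take to be the circle $S^1$. Let $\Gamma_{1,s}$ be the group of homotopy classes of self-homotopy equivalences $X\to X$ fixing each $x_i$, where homotopies are also required to fix the points $x_i$. Let $\hat\Gamma_{1,s}$ be the group of homotopy classes, relative to the marked points, of self-homotopy equivalences $f$ of $X$ that permute the marked points, $f(x_i)=x_{\sigma(i)}$ with $\sigma\in S_s$; it contains $\Gamma_{1,s}$ as the kernel of $f\mapsto\sigma$. Let $H^i(\Gamma_{1,s})$ denote group cohomology with trivial coefficients in $\Bbbk$; $f\in\hat\Gamma_{1,s}$ acts on it by pull-back along the automorphism $g\mapsto f^{-1}gf$ of $\Gamma_{1,s}$. For a partition $\lambda$ of $s$ let $P_\lambda$ be the irreducible representation of the symmetric group $S_s$ over $\Bbbk$ corresponding to $\lambda$ (the left ideal of $\Bbbk[S_s]$ generated by a Young symmetrizer of shape $\lambda$, so that $P_{(s)}$ is trivial and $P_{(1^s)}$ is the alternating representation). Every self-homotopy equivalence of $X$ that permutes the marked points is invertible up to homotopy relative to the marked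 points, the homomorphism $\hat\Gamma_{1,s}\to S_s$ is surjective, and the action of $\hat\Gamma_{1,s}$ on $H^i(\Gamma_{1,s})$ factors through a representation of $S_s$, for every $i\ge 0$. As a representation of $S_s$, $$H^i(\Gamma_{1,s})\cong\begin{cases}P_{(s-i,1^i)} & \text{if } i \text{ is even},\\ 0 & \text{if } i\text{ is odd,}\end{cases}$$ where $P_{(s-i,1^i)}$ is read as $0$ if $i\ge s$ and $i>0$, in which case $(s-i,1^i)$ is not a partition, and $(s-i,1^i)$ is the empty partition if $s=i=0$. In particular, for every $k\ge 0$, $H^{2k}(\Gamma_{1,2k+1})\cong P_{(1^{2k+1})}$ is one-dimensional, and a permutation acts on it as multiplication by its sign. -/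

import Mathlib

/-! ### Self-maps of a space with marked points, up to homotopy -/

/-- A continuous self-map of `X` that permutes the marked points `x i`, together with the
permutation it induces on them. -/
@[ext]
structure MarkedMap {X ι : Type*} [TopologicalSpace X] (x : ι → X) where
  toMap : C(X, X)
  perm : Equiv.Perm ι
  map_mark : ∀ i, toMap (x i) = x (perm i)

namespace MarkedMap

variable {X ι : Type*} [TopologicalSpace X] {x : ι → X}

/-- Marked self-maps form a monoid under composition. -/
instance : Monoid (MarkedMap x) where
  mul f g := ⟨f.toMap.comp g.toMap, f.perm * g.perm, fun i => by
    simp [g.map_mark, f.map_mark]⟩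
  one := ⟨ContinuousMap.id X, 1, fun i => by simp⟩
  mul_assoc f g h := rfl
  one_mul f := rfl
  mul_one f := rfl

/-- The permutation of the marked points, as a monoid homomorphism. -/
def permMonoidHom (x : ι → X) : MarkedMap x →* Equiv.Perm ι where
  toFun := MarkedMap.perm
  map_one' := rfl
  map_mul' _ _ := rfl

/-- Homotopy of marked self-maps, through homotopies that are fixed on the marked points, as a
congruence for composition. -/
def homotopyCon (x : ι → X) : Con (MarkedMap x) where
  r f g := f.perm = g.perm ∧ f.toMap.HomotopicRel g.toMap (Set.range x)
  iseqv :=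
    ⟨fun f => ⟨rfl, .refl _⟩, fun h => ⟨h.1.symm, h.2.symm⟩,
      fun h h' => ⟨h.1.trans h'.1, h.2.trans h'.2⟩⟩
  mul' := by
    rintro f f' g g' ⟨hp, ⟨F⟩⟩ ⟨hq, ⟨G⟩⟩
    refine ⟨congrArg₂ (· * ·) hp hq, ⟨⟨F.toHomotopy.comp G.toHomotopy, ?_⟩⟩⟩
    rintro t _ ⟨i, rfl⟩
    have h1 : G (t, x i) = x (g.perm i) := (G.eq_fst t ⟨i, rfl⟩).trans (g.map_mark i)
    have h2 : F (t, x (g.perm i)) = f.toMap (x (g.perm i)) := F.eq_fst t ⟨_, rfl⟩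
    change F (t, G (t, x i)) = f.toMap (g.toMap (x i))
    rw [h1, h2, g.map_mark]

/-- The underlying map is a homotopy equivalence of the space `X` (no condition on the marked
points is imposed on the homotopy inverse or on the homotopies). -/
def IsHomotopyEquiv (f : MarkedMap x) : Prop :=
  ∃ e : ContinuousMap.HomotopyEquiv X X, e.toFun = f.toMap

end MarkedMap

section MappingClassGroups

variable {X ι : Type*} [TopologicalSpace X]

/-- The group of homotopy classes, relative to the marked points, of self-homotopy equivalences
of `X` that permute the marked points. -/
abbrev ExtMCG (x : ι → X) : Type _ := ((MarkedMap.homotopyCon x).Quotient)ˣ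

/-- The action of a class on the set of marked points. -/
def permHom (x : ι → X) : ExtMCG x →* Equiv.Perm ι :=
  toUnits.symm.toMonoidHom.comp
    (Units.map ((MarkedMap.homotopyCon x).lift (MarkedMap.permMonoidHom x) fun _ _ h => h.1))

/-- The group `Γ(X, x)` of homotopy classes, relative to the marked points, of self-homotopy
equivalences of `X` that fix each marked point. For a finite connected graph `X` of rank `n` and
`s` distinct marked points this is the group `Γ_{n,s}`. -/
abbrev MCG (x : ι → X) : Subgroup (ExtMCG x) := (permHom x).ker

end MappingClassGroups

/-! ### Cohomology of `Γ(X, x)` and the action of classes permuting the marked points -/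

section Cohomology

universe u

variable (k : Type u) [Field k] {X ι : Type} [TopologicalSpace X]

/-- `H^i(Γ(X, x); k)`, group cohomology with trivial coefficients. The lift only moves the group
into the universe of `k`. -/
noncomputable abbrev MCGCohomology (x : ι → X) (i : ℕ) : ModuleCat.{u} k :=
  groupCohomology (Rep.trivial k (ULift.{u} (MCG x)) k) i

/-- Conjugation `g ↦ u g u⁻¹` on `Γ(X, x)` by a class `u` that permutes the marked points. -/
def conjHom {x : ι → X} (u : ExtMCG x) : ULift.{u} (MCG x) →* ULift.{u} (MCG x) :=
  MulEquiv.ulift.symm.toMonoidHom.comp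
    ((MulAut.conjNormal u : MCG x ≃* MCG x).toMonoidHom.comp MulEquiv.ulift.toMonoidHom)

/-- The (left) action of `u` on `H^i(Γ(X, x); k)`: pull-back along conjugation by `u⁻¹`. -/
noncomputable def conjAction {x : ι → X} (i : ℕ) (u : ExtMCG x) :
    MCGCohomology k x i →ₗ[k] MCGCohomology k x i :=
  (groupCohomology.map (A := Rep.trivial k (ULift.{u} (MCG x)) k)
    (B := Rep.trivial k (ULift.{u} (MCG x)) k) (conjHom u⁻¹)
    (Rep.ofHom ⟨LinearMap.id, fun _ => rfl⟩) i).hom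

/-- `ρ` is the representation of the group of permutations of the marked points induced by the
action of homotopy equivalences permuting the marked points. -/
def IsInducedAction {x : ι → X} {i : ℕ}
    (ρ : Representation k (Equiv.Perm ι) (MCGCohomology k x i)) : Prop :=
  ∀ u : ExtMCG x, ρ (permHom x u) = conjAction k i u

end Cohomology

/-! ### The irreducible representations `P_λ` of symmetric groups -/

section Specht

open scoped Classical in
/-- The Young symmetrizer `c = (∑ p) (∑ sign(q) q)` of a tableau `T`, i.e. a numbering of the
cells of a Young diagram; `p` runs over the permutations preserving every row, `q` over those
preserving every column. -/
noncomputable def youngSymmetrizer (k : Type*) [Field k] {s : ℕ} {μ : YoungDiagram}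
    (T : Fin s ≃ μ.cells) : MonoidAlgebra k (Equiv.Perm (Fin s)) :=
  (∑ p : Equiv.Perm (Fin s) with ∀ a, (T (p a)).1.1 = (T a).1.1, MonoidAlgebra.of k _ p) *
    ∑ q : Equiv.Perm (Fin s) with ∀ a, (T (q a)).1.2 = (T a).1.2,
      ((Equiv.Perm.sign q : ℤ) : k) • MonoidAlgebra.of k _ q

/-- The group algebra as a representation by left multiplication. -/
noncomputable def leftMulRep (k G : Type*) [Field k] [Group G] :
    Representation k G (MonoidAlgebra k G) :=
  (Algebra.lmul k (MonoidAlgebra k G)).toMonoidHom.comp (MonoidAlgebra.of k G)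

/-- The left ideal `k[S_s] c` generated by an element `c` of the group algebra. -/
noncomputable def leftIdeal {k G : Type*} [Field k] [Group G] (c : MonoidAlgebra k G) :
    Submodule k (MonoidAlgebra k G) :=
  LinearMap.range (LinearMap.mulRight k c)

theorem leftIdeal_le_comap {k G : Type*} [Field k] [Group G] (c : MonoidAlgebra k G) (g : G) :
    leftIdeal c ≤ (leftIdeal c).comap (leftMulRep k G g) := by
  rintro _ ⟨a, rfl⟩
  exact ⟨MonoidAlgebra.of k G g * a, mul_assoc _ _ _⟩

/-- A numbering of the cells of a Young diagram with `s` cells. (Different numberings give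
isomorphic representations below.) -/
noncomputable def numbering {s : ℕ} (μ : YoungDiagram) (h : μ.card = s) : Fin s ≃ μ.cells :=
  (μ.cells.equivFinOfCardEq h).symm

/-- The representation `P_μ` of the symmetric group `S_s` attached to a Young diagram with `s`
cells: the left ideal of `k[S_s]` generated by the Young symmetrizer. -/
noncomputable def spechtRep (k : Type*) [Field k] {s : ℕ} (μ : YoungDiagram) (h : μ.card = s) :
    Representation k (Equiv.Perm (Fin s)) (leftIdeal (youngSymmetrizer k (numbering μ h))) :=
  (leftMulRep k (Equiv.Perm (Fin s))).subrepresentation _ (leftIdeal_le_comap _)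

/-- The Young diagram of the hook partition `(s - i, 1^i)` of `s`. This is a partition exactly
when `i < s`, or when `i = 0` (for `s = i = 0` it is the empty partition). -/
def hookDiagram (s i : ℕ) (h : i < s ∨ i = 0) : YoungDiagram :=
  YoungDiagram.ofRowLens ((s - i) :: List.replicate i 1) <| by
    rw [List.sortedGE_iff_pairwise, List.pairwise_cons]
    refine ⟨fun b hb => ?_, List.pairwise_replicate.2 (Or.inr le_rfl)⟩
    obtain ⟨hi, rfl⟩ := List.mem_replicate.1 hb
    omega

theorem card_cellsOfRowLens (w : List ℕ) : (YoungDiagram.cellsOfRowLens w).card = w.sum := by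
  induction w with
  | nil => rfl
  | cons a w ih =>
    rw [YoungDiagram.cellsOfRowLens, Finset.card_union_of_disjoint]
    · simp [ih]
    · rw [Finset.disjoint_left]
      rintro ⟨a, b⟩ h1 h2
      simp only [Finset.mem_product, Finset.mem_singleton, Finset.mem_map] at h1 h2
      obtain ⟨c, -, hc⟩ := h2
      have := congrArg Prod.fst hc
      simp [h1.1] at this

theorem card_hookDiagram (s i : ℕ) (h : i < s ∨ i = 0) : (hookDiagram s i h).card = s := by
  refine (card_cellsOfRowLens _).trans ?_
  simp only [List.sum_cons, List.sum_replicate, smul_eq_mul, mul_one]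
  omega

end Specht

/-!
A self-map of the circle is `z ↦ z ^ d * exp (i φ z)` for its degree `d` and a real function
`φ`, which is unique up to a multiple of `2π`. Up to homotopy relative to the marked points, a
map that permutes these is therefore given by the permutation, by `d`, and by the values of `φ`
at the marked points, which amount to winding numbers in the lattice `L = ℤˢ / ℤ (1, …, 1)`
(`MarkedMap.homotopyCon_iff`). All values occur (`MarkedMap.exists_eq`), the map is invertible
exactly if `d = ±1` (`MarkedMap.isUnit_coe_iff`), and the classes that fix the marked points
form the generalized dihedral group `L ⋊ {±1}` (`MCG.generalizedDihedral`). Conjugation by a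
class of degree `d` with permutation `σ` acts on `L` by `d σ` (`MCG.conjHom_incl`).

Let `Γ = L ⋊ {±1}` and let `ε` be its sign character. An alternating `i`-form on `L` gives a
cocycle of `Γ` with coefficients in `ε ^ i`, namely the value of the form on the steps of the
path `1, g₀, g₀ g₁, …` in `L`. Restricting a cocycle to `L` and antisymmetrizing it recovers the
form up to the factor `i!` (`GeneralizedDihedral.toForm_ofForm`), so the forms embed into
`H^i(Γ, ε ^ i)`. On the other hand `H^i(Γ, k)` and `H^i(Γ, ε)` together are at most as large as
`H^i(L, k)`, by Shapiro's lemma for the subgroup `L` of index two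
(`finrank_groupCohomology_add_le`), and `H^i(L, k)` has dimension at most `(s - 1).choose i`, by
Shapiro's lemma again and induction on the rank (`finrank_groupCohomology_le_choose`). This is
already the dimension of the space of forms. Hence `H^i(Γ, k)` is the space of alternating
`i`-forms on `L` for `i` even, and zero for `i` odd. The degree acts on an `i`-form through its
`i`-th power, so for `i` even only the permutation matters (`conjAction_formEquiv`).

It remains to identify the alternating `i`-forms on `L` with the left ideal generated by the
Young symmetrizer `a b` of the hook `(s - i, 1^i)`. Let `y₀, …, yᵢ` be its first column, and let
`e_a` be the image in `L` of the `a`-th basis vector. The map sends `ω` to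
`(∑ g, ω (e_(g y₁), …, e_(g yᵢ)) g) b` (`hookMap`). The coefficient of `g` in this element is
`i! ω (e_(g y₁) - e_(g y₀), …, e_(g yᵢ) - e_(g y₀))` (`hookMap_eq`); summing over the entry
`g y₀` and using `∑ e_a = 0` gives `s ω (e_(g y₁), …, e_(g yᵢ))`, so the map is injective
(`hookMap_injective`). Its image is contained in the ideal, since the sum is invariant under the
row permutations (`hookMap_mem_leftIdeal`), and is all of it, since `a b` is the image of a
determinant, up to a factor (`exists_hookMap_eq`).
-/

/-! ### Self-maps of the circle -/

/-- `f` is the map `z ↦ z ^ d * exp (i φ z)`, where `φ` is a real-valued function on the circle.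
Every self-map `f` is of this form; `d` is its degree. -/
def HasAngle (f : C(Circle, Circle)) (d : ℤ) (φ : C(Circle, ℝ)) : Prop :=
  ∀ z, f z = z ^ d * Circle.exp (φ z)

/-- A lift of `f` to the real line is the sum of a linear function `d t` and a periodic one. -/
theorem exists_hasAngle (f : C(Circle, Circle)) : ∃ d φ, HasAngle f d φ := by
  have hπ : (0 : ℝ) < 2 * Real.pi := Real.two_pi_pos
  obtain ⟨e₀, he₀⟩ := Circle.exp_surjective (f (Circle.exp 0))
  obtain ⟨F, ⟨-, hF⟩, -⟩ := Circle.isCoveringMap_exp.existsUnique_continuousMap_lifts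
    (f.comp Circle.exp) (0 : ℝ) e₀ he₀
  have hF' : ∀ t, Circle.exp (F t) = f (Circle.exp t) := fun t => congrFun hF t
  obtain ⟨d, hd⟩ : ∃ d : ℤ, ∀ t, F (t + 2 * Real.pi) = F t + d * (2 * Real.pi) := by
    have h1 : ∀ t, ∃ m : ℤ, F (t + 2 * Real.pi) = F t + m * (2 * Real.pi) := fun t =>
      Circle.exp_eq_exp.1 (by rw [hF', hF', Circle.exp_add_two_pi])
    obtain ⟨d, hd⟩ := h1 0
    refine ⟨d, fun t => ?_⟩
    have key : (⟨fun t => F (t + 2 * Real.pi), by fun_prop⟩ : C(ℝ, ℝ)) =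
        ⟨fun t => F t + d * (2 * Real.pi), by fun_prop⟩ := by
      refine DFunLike.coe_injective (Circle.isCoveringMap_exp.eq_of_comp_eq
        (ContinuousMap.continuous _) (ContinuousMap.continuous _) ?_ 0 hd)
      funext t
      obtain ⟨m, hm⟩ := h1 t
      refine Circle.exp_eq_exp.2 ⟨m - d, ?_⟩
      simp only [ContinuousMap.coe_mk, hm]
      push_cast; ring
    exact DFunLike.congr_fun key t
  have hper : Function.Periodic (fun t => F t - d * t) (2 * Real.pi) := fun t => by
    simp only [hd]; ring
  have hcont : Continuous (hper.lift : AddCircle (2 * Real.pi) → ℝ) :=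
    continuous_coinduced_dom.2 (by
      change Continuous fun t => F t - d * t
      fun_prop)
  refine ⟨d, ⟨fun z => hper.lift (AddCircle.homeomorphCircle'.symm z), by fun_prop⟩, fun z => ?_⟩
  obtain ⟨t, rfl⟩ := Circle.exp_surjective z
  have h2 : AddCircle.homeomorphCircle'.symm (Circle.exp t) = (t : AddCircle (2 * Real.pi)) := by
    rw [Homeomorph.symm_apply_eq, AddCircle.homeomorphCircle'_apply_mk]
  simp only [ContinuousMap.coe_mk, h2, Function.Periodic.lift_coe, ← hF', ← Circle.exp_zsmul,
    ← Circle.exp_add]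
  congr 1
  simp

theorem HasAngle.unique {f : C(Circle, Circle)} {d e : ℤ} {φ ψ : C(Circle, ℝ)}
    (h : HasAngle f d φ) (h' : HasAngle f e ψ) :
    d = e ∧ ∃ m : ℤ, ∀ z, φ z = ψ z + m * (2 * Real.pi) := by
  have hπ : (0 : ℝ) < 2 * Real.pi := Real.two_pi_pos
  have h1 : ∀ t : ℝ, ∃ m : ℤ,
      d * t + φ (Circle.exp t) = (e * t + ψ (Circle.exp t)) + m * (2 * Real.pi) := fun t =>
    Circle.exp_eq_exp.1 (by
      have := (h (Circle.exp t)).symm.trans (h' (Circle.exp t))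
      rwa [← Circle.exp_zsmul, ← Circle.exp_zsmul, ← Circle.exp_add, ← Circle.exp_add,
        zsmul_eq_mul, zsmul_eq_mul] at this)
  obtain ⟨m, hm⟩ := h1 0
  have key : (fun t : ℝ => d * t + φ (Circle.exp t)) =
      fun t : ℝ => (e * t + ψ (Circle.exp t)) + m * (2 * Real.pi) := by
    refine Circle.isCoveringMap_exp.eq_of_comp_eq (by fun_prop) (by fun_prop) ?_ 0 hm
    funext t
    obtain ⟨m', hm'⟩ := h1 t
    refine Circle.exp_eq_exp.2 ⟨m' - m, ?_⟩
    simp only [hm']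
    push_cast; ring
  have hde : d = e := by
    have h2 := congrFun key (2 * Real.pi)
    simp only [Circle.exp_two_pi] at h2
    simp only [mul_zero, Circle.exp_zero] at hm
    have : (d : ℝ) * (2 * Real.pi) = e * (2 * Real.pi) := by linarith
    exact_mod_cast mul_right_cancel₀ hπ.ne' this
  subst hde
  refine ⟨rfl, m, fun z => ?_⟩
  obtain ⟨t, rfl⟩ := Circle.exp_surjective z
  linarith [congrFun key t]

theorem HasAngle.comp {f g : C(Circle, Circle)} {d e : ℤ} {φ ψ : C(Circle, ℝ)}
    (hf : HasAngle f d φ) (hg : HasAngle g e ψ) :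
    HasAngle (f.comp g) (d * e) (d • ψ + φ.comp g) := fun z => by
  rw [ContinuousMap.comp_apply, hf, hg, mul_zpow, ← zpow_mul, ← Circle.exp_zsmul, mul_assoc,
    ← Circle.exp_add, mul_comm e d, ← hg]
  rfl

/-- A homotopy starting at `f` is `f` times a homotopy starting at `1`, and the latter lifts to
the real line. -/
theorem HasAngle.of_homotopicRel {f g : C(Circle, Circle)} {d : ℤ} {φ : C(Circle, ℝ)}
    {S : Set Circle} (hf : HasAngle f d φ) (h : f.HomotopicRel g S) :
    ∃ ψ, HasAngle g d ψ ∧ ∀ z ∈ S, ψ z = φ z := by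
  obtain ⟨F⟩ := h
  let H : C(unitInterval × Circle, Circle) :=
    ⟨fun p => F p * (f p.2)⁻¹, by fun_prop⟩
  have H0 : ∀ z, H (0, z) = Circle.exp ((0 : C(Circle, ℝ)) z) := fun z => by
    simp [H]
  let K := Circle.isCoveringMap_exp.liftHomotopy H 0 H0
  have hK : ∀ p, Circle.exp (K p) = H p := fun p =>
    congrFun (Circle.isCoveringMap_exp.liftHomotopy_lifts H 0 H0) p
  have hK0 : ∀ z, K (0, z) = 0 := Circle.isCoveringMap_exp.liftHomotopy_zero H 0 H0
  refine ⟨φ + ⟨fun z => K (1, z), by fun_prop⟩, fun z => ?_, fun z hz => ?_⟩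
  · have h1 := hK (1, z)
    simp only [H, ContinuousMap.coe_mk, ContinuousMap.HomotopyWith.apply_one] at h1
    have h2 : (φ + ⟨fun z => K (1, z), by fun_prop⟩ : C(Circle, ℝ)) z = φ z + K (1, z) := rfl
    rw [h2, Circle.exp_add, ← mul_assoc, ← hf z, h1, mul_comm, inv_mul_cancel_right]
  · suffices K (1, z) = 0 by simp [this]
    have h2 : (fun t => K (t, z)) = fun _ => (0 : ℝ) := by
      refine Circle.isCoveringMap_exp.eq_of_comp_eq (by fun_prop) (by fun_prop) ?_ 0 (hK0 z)
      funext t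
      simp only [Function.comp, hK, H, ContinuousMap.coe_mk, F.eq_fst t hz, mul_inv_cancel,
        Circle.exp_zero]
    exact congrFun h2 1

/-- Two maps of the same degree are joined by the homotopy that interpolates their angles. -/
theorem HasAngle.homotopicRel {f g : C(Circle, Circle)} {d : ℤ} {φ ψ : C(Circle, ℝ)}
    {S : Set Circle} (hf : HasAngle f d φ) (hg : HasAngle g d ψ) (h : ∀ z ∈ S, ψ z = φ z) :
    f.HomotopicRel g S := by
  refine ⟨⟨⟨⟨fun p => p.2 ^ d * Circle.exp ((1 - (p.1 : ℝ)) * φ p.2 + p.1 * ψ p.2), ?_⟩,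
    fun z => ?_, fun z => ?_⟩, fun t z hz => ?_⟩⟩
  · fun_prop
  · simp [hf z]
  · simp [hg z]
  · simp only [ContinuousMap.coe_mk]
    rw [h z hz, hf z]
    congr 2
    ring

theorem HasAngle.id : HasAngle (ContinuousMap.id Circle) 1 0 := fun z => by simp

/-- The map with the given degree and angle function. -/
theorem exists_of_hasAngle (d : ℤ) (φ : C(Circle, ℝ)) : ∃ f, HasAngle f d φ :=
  ⟨⟨fun z => z ^ d * Circle.exp (φ z), by fun_prop⟩, fun _ => rfl⟩

/-- A real-valued function on the circle with prescribed values at finitely many points. -/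
theorem exists_continuousMap_eq {s : ℕ} {x : Fin s → Circle} (hx : Function.Injective x)
    (v : Fin s → ℝ) : ∃ φ : C(Circle, ℝ), ∀ i, φ (x i) = v i := by
  have hfin : (Set.range x).Finite := Set.finite_range x
  have : Finite (Set.range x) := hfin
  have hT : T1Space (Set.range x) := inferInstance
  have : DiscreteTopology (Set.range x) := inferInstance
  obtain ⟨φ, hφ⟩ := ContinuousMap.exists_restrict_eq hfin.isClosed
    (⟨fun z => v ((Equiv.ofInjective x hx).symm z), continuous_of_discreteTopology⟩ :
      C(Set.range x, ℝ))
  refine ⟨φ, fun i => ?_⟩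
  have := DFunLike.congr_fun hφ ⟨x i, i, rfl⟩
  simpa using this

/-! ### Marked self-maps of the circle up to homotopy -/

namespace MarkedMap

variable {s : ℕ} {x : Fin s → Circle}

/-- The marked map `f` has degree `d` and winding numbers `n`: a lift of `f` to the real line,
which satisfies `F (t + 2π) = F t + 2πd`, sends the lift `arg (x i)` of the `i`-th marked point
to the translate by `2π n i` of the chosen lift of the marked point `f (x i)`. -/
def HasType (f : MarkedMap x) (d : ℤ) (n : Fin s → ℤ) : Prop :=
  ∃ φ, HasAngle f.toMap d φ ∧ ∀ i,
    d * (x i : ℂ).arg + φ (x i) = (x (f.perm i) : ℂ).arg + n i * (2 * Real.pi)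

theorem exp_arg_add (d : ℤ) (φ : C(Circle, ℝ)) (z : Circle) :
    Circle.exp (d * (z : ℂ).arg + φ z) = z ^ d * Circle.exp (φ z) := by
  rw [Circle.exp_add, ← zsmul_eq_mul, Circle.exp_zsmul, Circle.exp_arg]

theorem exists_hasType (f : MarkedMap x) : ∃ d n, f.HasType d n := by
  obtain ⟨d, φ, h⟩ := exists_hasAngle f.toMap
  have h1 : ∀ i, ∃ m : ℤ,
      d * (x i : ℂ).arg + φ (x i) = (x (f.perm i) : ℂ).arg + m * (2 * Real.pi) := fun i => by
    refine Circle.exp_eq_exp.1 ?_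
    rw [exp_arg_add, ← h, f.map_mark, Circle.exp_arg]
  choose n hn using h1
  exact ⟨d, n, φ, h, hn⟩

theorem HasType.unique {f : MarkedMap x} {d e : ℤ} {n m : Fin s → ℤ} (h : f.HasType d n)
    (h' : f.HasType e m) : d = e ∧ ∃ c : ℤ, ∀ i, n i = m i + c := by
  obtain ⟨φ, hφ, hn⟩ := h
  obtain ⟨ψ, hψ, hm⟩ := h'
  obtain ⟨rfl, c, hc⟩ := hφ.unique hψ
  refine ⟨rfl, c, fun i => ?_⟩
  have h1 := hn i
  have h2 := hm i
  rw [hc] at h1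
  have : (n i : ℝ) * (2 * Real.pi) = ((m i + c : ℤ) : ℝ) * (2 * Real.pi) := by
    push_cast; linarith
  exact_mod_cast mul_right_cancel₀ Real.two_pi_pos.ne' this

theorem HasType.add_const {f : MarkedMap x} {d : ℤ} {n : Fin s → ℤ} (h : f.HasType d n) (c : ℤ) :
    f.HasType d fun i => n i + c := by
  obtain ⟨φ, hφ, hn⟩ := h
  refine ⟨φ + ContinuousMap.const _ (c * (2 * Real.pi)), fun z => ?_, fun i => ?_⟩
  · rw [hφ z, ContinuousMap.add_apply, Circle.exp_add, ContinuousMap.const_apply,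
      Circle.exp_int_mul_two_pi, mul_one]
  · simp only [ContinuousMap.add_apply, ContinuousMap.const_apply]
    push_cast
    linarith [hn i]

theorem HasType.mul {f g : MarkedMap x} {d e : ℤ} {n m : Fin s → ℤ} (hf : f.HasType d n)
    (hg : g.HasType e m) : (f * g).HasType (d * e) fun i => n (g.perm i) + d * m i := by
  obtain ⟨φ, hφ, hn⟩ := hf
  obtain ⟨ψ, hψ, hm⟩ := hg
  refine ⟨_, hφ.comp hψ, fun i => ?_⟩
  have h1 : (d • ψ + φ.comp g.toMap) (x i) = d * ψ (x i) + φ (x (g.perm i)) := by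
    simp [g.map_mark]
  have h2 : (f * g).perm i = f.perm (g.perm i) := rfl
  rw [h1, h2]
  push_cast
  linear_combination hn (g.perm i) + (d : ℝ) * hm i

theorem HasType.one : (1 : MarkedMap x).HasType 1 0 :=
  ⟨0, HasAngle.id, fun i => by
    have : (1 : MarkedMap x).perm i = i := rfl
    simp [this]⟩

theorem HasType.congr {f g : MarkedMap x} {d : ℤ} {n : Fin s → ℤ} (hf : f.HasType d n)
    (h : homotopyCon x f g) : g.HasType d n := by
  obtain ⟨φ, hφ, hn⟩ := hf
  obtain ⟨ψ, hψ, hm⟩ := hφ.of_homotopicRel h.2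
  exact ⟨ψ, hψ, fun i => by rw [hm _ ⟨i, rfl⟩, hn, h.1]⟩

theorem HasType.homotopyCon {f g : MarkedMap x} {d : ℤ} {n : Fin s → ℤ} (hf : f.HasType d n)
    (hg : g.HasType d n) (h : f.perm = g.perm) : homotopyCon x f g := by
  obtain ⟨φ, hφ, hn⟩ := hf
  obtain ⟨ψ, hψ, hm⟩ := hg
  refine ⟨h, hφ.homotopicRel hψ ?_⟩
  rintro _ ⟨i, rfl⟩
  have h1 := hn i
  rw [h] at h1
  linarith [hm i]

theorem exists_of_hasType (hx : Function.Injective x) (d : ℤ) (σ : Equiv.Perm (Fin s))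
    (n : Fin s → ℤ) : ∃ f : MarkedMap x, f.perm = σ ∧ f.HasType d n := by
  obtain ⟨φ, hφ⟩ := exists_continuousMap_eq hx fun i =>
    (x (σ i) : ℂ).arg + n i * (2 * Real.pi) - d * (x i : ℂ).arg
  obtain ⟨f, hf⟩ := exists_of_hasAngle d φ
  refine ⟨⟨f, σ, fun i => ?_⟩, rfl, φ, hf, fun i => ?_⟩
  · rw [hf, ← exp_arg_add, hφ, add_sub_cancel, Circle.exp_add, Circle.exp_int_mul_two_pi, mul_one,
      Circle.exp_arg]
  · rw [hφ, add_sub_cancel]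

/-- The degree of a marked map. -/
noncomputable def degree (f : MarkedMap x) : ℤ := f.exists_hasType.choose

theorem HasType.degree_eq {f : MarkedMap x} {d : ℤ} {n : Fin s → ℤ} (h : f.HasType d n) :
    f.degree = d := (f.exists_hasType.choose_spec.choose_spec.unique h).1

/-- The lattice `ℤˢ / ℤ (1, …, 1)` in which the winding numbers of a marked map live: they are
defined up to a common summand, which comes from the choice of a lift to the real line. -/
abbrev _root_.WindingLattice (s : ℕ) : Type := (Fin s → ℤ) ⧸ Submodule.span ℤ {(1 : Fin s → ℤ)}

theorem _root_.WindingLattice.mk_eq_mk {n m : Fin s → ℤ} :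
    (Submodule.Quotient.mk n : WindingLattice s) = Submodule.Quotient.mk m ↔
      ∃ c : ℤ, ∀ i, n i = m i + c := by
  rw [Submodule.Quotient.eq, Submodule.mem_span_singleton]
  refine exists_congr fun c => ?_
  simp only [funext_iff, Pi.smul_apply, Pi.one_apply, smul_eq_mul, mul_one, Pi.sub_apply]
  exact forall_congr' fun i => ⟨fun h => by omega, fun h => by omega⟩

/-- The winding numbers of a marked map. -/
noncomputable def winding (f : MarkedMap x) : WindingLattice s :=
  Submodule.Quotient.mk f.exists_hasType.choose_spec.choose

theorem HasType.winding_eq {f : MarkedMap x} {d : ℤ} {n : Fin s → ℤ} (h : f.HasType d n) :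
    f.winding = Submodule.Quotient.mk n :=
  WindingLattice.mk_eq_mk.2 (f.exists_hasType.choose_spec.choose_spec.unique h).2

theorem hasType_iff {f : MarkedMap x} {d : ℤ} {n : Fin s → ℤ} :
    f.HasType d n ↔ f.degree = d ∧ f.winding = Submodule.Quotient.mk n := by
  refine ⟨fun h => ⟨h.degree_eq, h.winding_eq⟩, ?_⟩
  rintro ⟨rfl, h⟩
  obtain ⟨e, m, hm⟩ := f.exists_hasType
  rw [hm.winding_eq, WindingLattice.mk_eq_mk] at h
  obtain ⟨c, hc⟩ := h
  rw [hm.degree_eq]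
  convert hm.add_const (-c) using 2 with i
  rw [hc]; ring

/-- The left action of permutations on the winding lattice, `n ↦ n ∘ σ⁻¹`. -/
def _root_.WindingLattice.perm (s : ℕ) :
    Equiv.Perm (Fin s) →* (WindingLattice s →ₗ[ℤ] WindingLattice s) where
  toFun σ := Submodule.mapQ _ _ (LinearMap.funLeft ℤ ℤ (σ⁻¹ : Equiv.Perm (Fin s))) (by
    rw [Submodule.span_singleton_le_iff_mem]
    exact Submodule.subset_span rfl)
  map_one' := by ext; rfl
  map_mul' σ τ := by ext; rfl

theorem _root_.WindingLattice.perm_mk (σ : Equiv.Perm (Fin s)) (n : Fin s → ℤ) :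
    WindingLattice.perm s σ (Submodule.Quotient.mk n) =
      Submodule.Quotient.mk (n ∘ (σ⁻¹ : Equiv.Perm (Fin s))) := rfl

theorem degree_mul (f g : MarkedMap x) : (f * g).degree = f.degree * g.degree := by
  obtain ⟨d, n, hf⟩ := f.exists_hasType
  obtain ⟨e, m, hg⟩ := g.exists_hasType
  rw [hf.degree_eq, hg.degree_eq, (hf.mul hg).degree_eq]

theorem winding_mul (f g : MarkedMap x) :
    (f * g).winding = WindingLattice.perm s g.perm⁻¹ f.winding + f.degree • g.winding := by
  obtain ⟨d, n, hf⟩ := f.exists_hasType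
  obtain ⟨e, m, hg⟩ := g.exists_hasType
  rw [hf.degree_eq, hf.winding_eq, hg.winding_eq, (hf.mul hg).winding_eq, WindingLattice.perm_mk,
    inv_inv]
  rfl

theorem degree_one : (1 : MarkedMap x).degree = 1 := HasType.one.degree_eq

theorem homotopyCon_iff {f g : MarkedMap x} : MarkedMap.homotopyCon x f g ↔
    f.perm = g.perm ∧ f.degree = g.degree ∧ f.winding = g.winding := by
  obtain ⟨d, n, hf⟩ := f.exists_hasType
  refine ⟨fun h => ⟨h.1, ?_⟩, fun h => ?_⟩
  · have hg := hf.congr h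
    exact ⟨hf.degree_eq.trans hg.degree_eq.symm, hf.winding_eq.trans hg.winding_eq.symm⟩
  · refine hf.homotopyCon (hasType_iff.2 ?_) h.1
    exact ⟨h.2.1.symm.trans hf.degree_eq, h.2.2.symm.trans hf.winding_eq⟩

theorem exists_eq (hx : Function.Injective x) (d : ℤ) (σ : Equiv.Perm (Fin s))
    (l : WindingLattice s) : ∃ f : MarkedMap x, f.perm = σ ∧ f.degree = d ∧ f.winding = l := by
  obtain ⟨n, rfl⟩ := Submodule.Quotient.mk_surjective _ l
  obtain ⟨f, hf, h⟩ := exists_of_hasType hx d σ n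
  exact ⟨f, hf, hasType_iff.1 h⟩

/-- The degree of a homotopy equivalence is invertible: forgetting the marked points, the degree
is multiplicative and homotopy invariant. -/
theorem isUnit_degree (f : MarkedMap x) (h : f.IsHomotopyEquiv) : IsUnit f.degree := by
  obtain ⟨e, he⟩ := h
  obtain ⟨d, n, φ, hφ, hn⟩ := f.exists_hasType
  rw [HasType.degree_eq ⟨φ, hφ, hn⟩]
  obtain ⟨d', ψ, hψ⟩ := exists_hasAngle e.invFun
  have h1 := hφ.comp hψ
  rw [← he] at h1
  have h2 : (e.toFun.comp e.invFun).HomotopicRel (ContinuousMap.id _) ∅ :=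
    ContinuousMap.homotopicRel_empty.2 e.right_inv
  obtain ⟨χ, hχ, -⟩ := h1.of_homotopicRel h2
  exact IsUnit.of_mul_eq_one _ (hχ.unique HasAngle.id).1

/-- A marked map of degree `±1` has an inverse up to homotopy, since a marked map with any given
permutation, degree and winding numbers exists. -/
theorem isUnit_coe_iff (hx : Function.Injective x) (f : MarkedMap x) :
    IsUnit (f : (MarkedMap.homotopyCon x).Quotient) ↔ IsUnit f.degree := by
  constructor
  · rintro h
    obtain ⟨b, hb⟩ := h.exists_right_inv
    induction b using Con.induction_on with
    | H g =>
      rw [← Con.coe_mul, ← Con.coe_one, Con.eq, homotopyCon_iff, degree_mul, degree_one] at hb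
      exact IsUnit.of_mul_eq_one _ hb.2.1
  · intro h
    have hd : f.degree * f.degree = 1 := by
      rcases Int.isUnit_iff.1 h with h | h <;> rw [h] <;> rfl
    have winding_one : (1 : MarkedMap x).winding = 0 := HasType.one.winding_eq
    obtain ⟨g, hg1, hg2, hg3⟩ := exists_eq hx f.degree f.perm⁻¹
      (-(f.degree • WindingLattice.perm s f.perm f.winding))
    refine isUnit_iff_exists.2 ⟨(g : (MarkedMap.homotopyCon x).Quotient), ?_, ?_⟩
    · rw [← Con.coe_mul, ← Con.coe_one, Con.eq, homotopyCon_iff, degree_mul, degree_one,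
        winding_mul, hg1, hg2, hg3, winding_one, inv_inv, smul_neg, smul_smul, hd, one_smul]
      exact ⟨by change f.perm * g.perm = 1; rw [hg1, mul_inv_cancel], rfl, add_neg_cancel _⟩
    · rw [← Con.coe_mul, ← Con.coe_one, Con.eq, homotopyCon_iff, degree_mul, degree_one,
        winding_mul, hg2, hg3, winding_one, map_neg, map_smul, ← Module.End.mul_apply, ← map_mul,
        inv_mul_cancel, map_one, Module.End.one_apply]
      exact ⟨by change g.perm * f.perm = 1; rw [hg1, inv_mul_cancel], hd, neg_add_cancel _⟩

end MarkedMap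

section ExtMCG

variable {s : ℕ} {x : Fin s → Circle}

/-- The degree of a homotopy class. -/
noncomputable def degHom (x : Fin s → Circle) : ExtMCG x →* ℤˣ :=
  Units.map ((MarkedMap.homotopyCon x).lift ⟨⟨MarkedMap.degree, MarkedMap.degree_one⟩,
    MarkedMap.degree_mul⟩ fun _ _ h => (MarkedMap.homotopyCon_iff.1 h).2.1)

/-- The winding numbers of a homotopy class. -/
noncomputable def windingNumbers (u : ExtMCG x) : WindingLattice s :=
  Con.liftOn (u : (MarkedMap.homotopyCon x).Quotient) MarkedMap.winding
    fun _ _ h => (MarkedMap.homotopyCon_iff.1 h).2.2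

theorem windingNumbers_mul (u v : ExtMCG x) : windingNumbers (u * v) =
    WindingLattice.perm s (permHom x v)⁻¹ (windingNumbers u) + degHom x u • windingNumbers v := by
  obtain ⟨u, u', h1, h2⟩ := u
  obtain ⟨v, v', h3, h4⟩ := v
  induction u using Con.induction_on with
  | H f =>
    induction v using Con.induction_on with
    | H g => exact MarkedMap.winding_mul f g

theorem ExtMCG.ext {u v : ExtMCG x} (h1 : permHom x u = permHom x v)
    (h2 : degHom x u = degHom x v) (h3 : windingNumbers u = windingNumbers v) : u = v := by
  refine Units.ext ?_
  have h2' := congrArg Units.val h2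
  obtain ⟨u, u', _, _⟩ := u
  obtain ⟨v, v', _, _⟩ := v
  induction u using Con.induction_on with
  | H f =>
    induction v using Con.induction_on with
    | H g => exact (Con.eq _).2 (MarkedMap.homotopyCon_iff.2 ⟨h1, h2', h3⟩)

theorem ExtMCG.exists_eq (hx : Function.Injective x) (σ : Equiv.Perm (Fin s)) (d : ℤˣ)
    (l : WindingLattice s) :
    ∃ u : ExtMCG x, permHom x u = σ ∧ degHom x u = d ∧ windingNumbers u = l := by
  obtain ⟨f, h1, h2, h3⟩ := MarkedMap.exists_eq hx (d : ℤ) σ l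
  obtain ⟨u, hu⟩ := (MarkedMap.isUnit_coe_iff hx f).2 (h2 ▸ d.isUnit)
  obtain ⟨u, u', h, h'⟩ := u
  subst hu
  exact ⟨⟨f, u', h, h'⟩, h1, Units.ext h2, h3⟩

end ExtMCG

/-! ### Upper bounds for cohomology from coinduced modules -/

section CohomologyBound

universe u

open CategoryTheory

variable {k : Type u} [Field k] {G : Type u} [Group G]

/-- The functions on the right cosets of `S`, as a representation of `G`. -/
noncomputable abbrev cosetFunctions (k : Type u) [Field k] (S : Subgroup G) : Rep k G :=
  Rep.coind S.subtype (Rep.trivial k S k)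

theorem cosetFunctions_apply {S : Subgroup G} (f : cosetFunctions k S) {g : G} (hg : g ∈ S)
    (h : G) : f.1 (g * h) = f.1 h := f.2 ⟨g, hg⟩ h

/-- The constant functions on the cosets. -/
noncomputable def constFunctions (k : Type u) [Field k] (S : Subgroup G) :
    Rep.trivial k G k ⟶ cosetFunctions k S :=
  Rep.ofHom ⟨{ toFun c := ⟨fun _ => c, fun _ _ => rfl⟩
               map_add' _ _ := rfl
               map_smul' _ _ := rfl }, fun _ => rfl⟩

/-- The difference operator `f ↦ f (t ·) - f` on the functions on the cosets of a normal
subgroup. -/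
noncomputable def differenceOperator (k : Type u) [Field k] (S : Subgroup G) [S.Normal] (t : G) :
    cosetFunctions k S ⟶ cosetFunctions k S :=
  Rep.ofHom ⟨{ toFun f := ⟨fun g => f.1 (t * g) - f.1 g, fun n h => by
                 have h1 : t * (n.1 * h) = t * n.1 * t⁻¹ * (t * h) := by group
                 have h2 := cosetFunctions_apply f (‹S.Normal›.conj_mem n.1 n.2 t) (t * h)
                 have h3 := cosetFunctions_apply f n.2 h
                 change f.1 (t * (n.1 * h)) - f.1 (n.1 * h) = f.1 (t * h) - f.1 h
                 rw [h1, h2, h3]⟩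
               map_add' f g := by
                 refine Subtype.ext (funext fun h => ?_)
                 change (f.1 _ + g.1 _) - (f.1 _ + g.1 _) = (f.1 _ - f.1 _) + (g.1 _ - g.1 _)
                 ring
               map_smul' c f := by
                 refine Subtype.ext (funext fun h => ?_)
                 change c * f.1 _ - c * f.1 _ = c * (f.1 _ - f.1 _)
                 ring }, fun g => by
    refine LinearMap.ext fun f => Subtype.ext (funext fun h => ?_)
    change f.1 (t * h * g) - f.1 (h * g) = f.1 (t * (h * g)) - f.1 (h * g)
    rw [mul_assoc]⟩

/-- Discrete integration. -/
theorem exists_sub_eq (f : ℤ → k) : ∃ F : ℤ → k, ∀ m, F (m + 1) - F m = f m := by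
  refine ⟨fun m => ∑ j ∈ Finset.Ico 0 m, f j - ∑ j ∈ Finset.Ico m 0, f j, fun m => ?_⟩
  beta_reduce
  rcases le_or_gt 0 m with h | h
  · rw [Finset.Ico_eq_empty_of_le (a := m + 1) (by omega), Finset.Ico_eq_empty_of_le h,
      ← Finset.insert_Ico_right_eq_Ico_add_one h, Finset.sum_insert (by simp)]
    simp
  · rw [Finset.Ico_eq_empty_of_le (b := m + 1) (by omega), Finset.Ico_eq_empty_of_le h.le,
      ← Finset.insert_Ico_add_one_left_eq_Ico h, Finset.sum_insert (by simp)]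
    simp

/-- For an infinite cyclic quotient `G / S`, the sequence `0 → k → k^(G/S) → k^(G/S) → 0` given
by the constant functions and the difference operator. -/
noncomputable def differenceSequence (k : Type u) [Field k] (π : G →* Multiplicative ℤ) (t : G) :
    ShortComplex (Rep k G) where
  X₁ := Rep.trivial k G k
  X₂ := cosetFunctions k π.ker
  X₃ := cosetFunctions k π.ker
  f := constFunctions k π.ker
  g := differenceOperator k π.ker t
  zero := by
    refine Rep.hom_ext (DFunLike.ext _ _ fun c => Subtype.ext (funext fun h => ?_))
    exact sub_self c

theorem mul_zpow_inv_mem_ker (π : G →* Multiplicative ℤ) {t : G}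
    (ht : π t = Multiplicative.ofAdd 1) (g : G) : g * (t ^ (π g).toAdd)⁻¹ ∈ π.ker := by
  rw [MonoidHom.mem_ker, map_mul, map_inv, map_zpow, ht, ← ofAdd_zsmul, smul_eq_mul, mul_one,
    ofAdd_toAdd, mul_inv_cancel]

theorem cosetFunctions_eq_apply_zpow (π : G →* Multiplicative ℤ) {t : G}
    (ht : π t = Multiplicative.ofAdd 1) (f : cosetFunctions k π.ker) (g : G) :
    f.1 g = f.1 (t ^ (π g).toAdd) := by
  have h := cosetFunctions_apply f (mul_zpow_inv_mem_ker π ht g) (t ^ (π g).toAdd)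
  rwa [inv_mul_cancel_right] at h

theorem eq_const_of_translation_invariant (π : G →* Multiplicative ℤ) {t : G}
    (ht : π t = Multiplicative.ofAdd 1) (f : cosetFunctions k π.ker)
    (h : ∀ g, f.1 (t * g) = f.1 g) (g : G) : f.1 g = f.1 1 := by
  have h1 : ∀ m : ℤ, f.1 (t ^ (m + 1)) = f.1 (t ^ m) := fun m => by
    rw [add_comm, zpow_one_add, h]
  have h2 : ∀ m : ℤ, f.1 (t ^ m) = f.1 1 := fun m => by
    induction m using Int.induction_on with
    | zero => rw [zpow_zero]
    | succ i ih => exact (h1 i).trans ih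
    | pred i ih =>
      have := h1 (-i - 1)
      rw [sub_add_cancel] at this
      exact this.symm.trans ih
  rw [cosetFunctions_eq_apply_zpow π ht, h2]

theorem differenceSequence_shortExact (π : G →* Multiplicative ℤ) {t : G}
    (ht : π t = Multiplicative.ofAdd 1) : (differenceSequence k π t).ShortExact where
  exact := (forget₂ (Rep k G) (ModuleCat k)).reflects_exact_of_faithful _ <|
    (ShortComplex.moduleCat_exact_iff _).2 fun f hf =>
      have h := eq_const_of_translation_invariant π ht f fun g =>
        sub_eq_zero.1 (congrFun (congrArg Subtype.val hf) g)
      ⟨f.1 1, Subtype.ext (funext fun g => (h g).symm)⟩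
  mono_f := (Rep.mono_iff_injective _).2 fun a b h => congrFun (congrArg Subtype.val h) 1
  epi_g := (Rep.epi_iff_surjective _).2 fun f => by
    obtain ⟨F, hF⟩ := exists_sub_eq fun m => f.1 (t ^ m)
    refine ⟨⟨fun g => F (π g).toAdd, fun n h => ?_⟩, Subtype.ext (funext fun g => ?_)⟩
    · change F (π (n.1 * h)).toAdd = F (π h).toAdd
      rw [map_mul, n.2, one_mul]
    · change F (π (t * g)).toAdd - F (π g).toAdd = f.1 g
      rw [map_mul, ht, toAdd_mul, toAdd_ofAdd, add_comm, hF]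
      exact (cosetFunctions_eq_apply_zpow π ht f g).symm

theorem finrank_le_of_exact {S : ShortComplex (ModuleCat.{u} k)} (hS : S.Exact)
    [Module.Finite k S.X₁] [Module.Finite k S.X₃] :
    Module.Finite k S.X₂ ∧
      Module.finrank k S.X₂ ≤ Module.finrank k S.X₁ + Module.finrank k S.X₃ := by
  have h1 := hS.moduleCat_range_eq_ker
  have h2 : Module.Finite k (LinearMap.ker S.g.hom) := by rw [← h1]; infer_instance
  have h3 : Module.Finite k S.X₂ := by
    have := Module.Finite.equiv (LinearMap.quotKerEquivRange S.g.hom).symm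
    exact Module.Finite.of_submodule_quotient (LinearMap.ker S.g.hom)
  refine ⟨h3, ?_⟩
  rw [← LinearMap.finrank_range_add_finrank_ker S.g.hom, ← h1, add_comm]
  exact add_le_add (LinearMap.finrank_range_le _) (Submodule.finrank_le _)

/-- The bound for `H^i` when `G / S` is infinite cyclic (Wang's exact sequence). -/
theorem finrank_groupCohomology_le_of_ker (π : G →* Multiplicative ℤ) {t : G}
    (ht : π t = Multiplicative.ofAdd 1) (b : ℕ → ℕ)
    (hb : ∀ i, Module.Finite k (groupCohomology (Rep.trivial k π.ker k) i) ∧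
      Module.finrank k (groupCohomology (Rep.trivial k π.ker k) i) ≤ b i) (i : ℕ) :
    Module.Finite k (groupCohomology (Rep.trivial k G k) (i + 1)) ∧
      Module.finrank k (groupCohomology (Rep.trivial k G k) (i + 1)) ≤ b i + b (i + 1) := by
  have hX := differenceSequence_shortExact (k := k) π ht
  let e := fun j => (groupCohomology.coindIso (Rep.trivial k π.ker k) j).toLinearEquiv
  have hf : ∀ j, Module.Finite k (groupCohomology (cosetFunctions k π.ker) j) := fun j =>
    have := (hb j).1
    Module.Finite.equiv (e j).symm
  -- `H^i(k^(G/S)) → H^(i+1)(k) → H^(i+1)(k^(G/S))`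
  have hE := groupCohomology.mapShortComplex₁_exact hX (rfl : i + 1 = i + 1)
  have : Module.Finite k (groupCohomology.mapShortComplex₁ hX (rfl : i + 1 = i + 1)).X₁ := hf i
  have : Module.Finite k (groupCohomology.mapShortComplex₁ hX (rfl : i + 1 = i + 1)).X₃ :=
    hf (i + 1)
  obtain ⟨h1, h2⟩ := finrank_le_of_exact hE
  exact ⟨h1, h2.trans (add_le_add ((e i).finrank_eq.trans_le (hb i).2)
    ((e (i + 1)).finrank_eq.trans_le (hb (i + 1)).2))⟩

theorem finrank_groupCohomology_zero :
    Module.Finite k (groupCohomology (Rep.trivial k G k) 0) ∧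
      Module.finrank k (groupCohomology (Rep.trivial k G k) 0) ≤ 1 := by
  let e := (groupCohomology.H0IsoOfIsTrivial (Rep.trivial k G k)).toLinearEquiv
  have e' : groupCohomology (Rep.trivial k G k) 0 ≃ₗ[k] k := e
  exact ⟨Module.Finite.equiv e'.symm, (e'.finrank_eq.trans (Module.finrank_self k)).le⟩

/-- The cohomology of a free abelian group of rank `n` is at most as large as the exterior algebra
on `n` generators. -/
theorem finrank_groupCohomology_le_choose (n : ℕ) (G : Type u) [Group G]
    (e : G ≃* Multiplicative (Fin n → ℤ)) (i : ℕ) :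
    Module.Finite k (groupCohomology (Rep.trivial k G k) i) ∧
      Module.finrank k (groupCohomology (Rep.trivial k G k) i) ≤ n.choose i := by
  induction n generalizing G i with
  | zero =>
    have : Subsingleton G := e.toEquiv.subsingleton
    cases i with
    | zero => simpa using finrank_groupCohomology_zero
    | succ i =>
      have := ModuleCat.subsingleton_of_isZero
        (isZero_groupCohomology_succ_of_subsingleton (Rep.trivial k G k) i)
      exact ⟨inferInstance, by simp [Module.finrank_zero_of_subsingleton]⟩
  | succ n ih =>
    cases i with
    | zero => simpa using finrank_groupCohomology_zero
    | succ i =>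
      let π : G →* Multiplicative ℤ :=
        (AddMonoidHom.toMultiplicative (Pi.evalAddMonoidHom (fun _ : Fin (n + 1) => ℤ) 0)).comp
          e.toMonoidHom
      have hπ : ∀ g, (π g).toAdd = (e g).toAdd 0 := fun g => rfl
      let e' : π.ker ≃* Multiplicative (Fin n → ℤ) :=
        { toFun g := Multiplicative.ofAdd fun j => (e g.1).toAdd j.succ
          invFun v := ⟨e.symm (Multiplicative.ofAdd (Fin.cons 0 v.toAdd)), by
            rw [MonoidHom.mem_ker]
            refine Multiplicative.toAdd.injective ?_
            rw [hπ, MulEquiv.apply_symm_apply]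
            rfl⟩
          left_inv g := by
            refine Subtype.ext ((MulEquiv.symm_apply_eq e).2 ?_)
            refine Multiplicative.toAdd.injective (funext fun j => ?_)
            refine Fin.cases ?_ (fun j => rfl) j
            have := congrArg Multiplicative.toAdd (MonoidHom.mem_ker.1 g.2)
            rw [hπ] at this
            exact this.symm
          right_inv v := by
            refine Multiplicative.toAdd.injective (funext fun j => ?_)
            simp
          map_mul' g h := by
            refine Multiplicative.toAdd.injective (funext fun j => ?_)
            simp }
      have ht : π (e.symm (Multiplicative.ofAdd fun _ => 1)) = Multiplicative.ofAdd 1 := by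
        refine Multiplicative.toAdd.injective ?_
        rw [hπ, MulEquiv.apply_symm_apply]
        rfl
      rw [Nat.choose_succ_succ]
      exact finrank_groupCohomology_le_of_ker π ht _ (fun j => ih π.ker e' j) i

/-- The representation of `G` on `k` through the power `ε ^ j` of a sign character. -/
noncomputable def signRep (k : Type u) [Field k] (ε : G →* ℤˣ) (j : ℕ) : Representation k G k where
  toFun g := ((ε g : ℤ) : k) ^ j • LinearMap.id
  map_one' := by ext; simp
  map_mul' g h := by ext; simp [mul_pow, mul_comm]

theorem signRep_apply (ε : G →* ℤˣ) (j : ℕ) (g : G) (c : k) :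
    signRep k ε j g c = ((ε g : ℤ) : k) ^ j * c := rfl

theorem signRep_even (ε : G →* ℤˣ) {j : ℕ} (hj : Even j) :
    signRep k ε j = Representation.trivial k G k := by
  ext g
  obtain ⟨r, rfl⟩ := hj
  rw [signRep_apply]
  rcases Int.units_eq_one_or (ε g) with h | h <;> simp [h]

theorem signRep_odd (ε : G →* ℤˣ) {j : ℕ} (hj : Odd j) :
    signRep k ε j = signRep k ε 1 := by
  ext g
  rw [signRep_apply, signRep_apply]
  rcases Int.units_eq_one_or (ε g) with h | h <;> simp [h, hj]

/-- The representation through `ε ^ j` as functions on the cosets of the kernel of `ε`. -/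
noncomputable def signFunctions (k : Type u) [Field k] (ε : G →* ℤˣ) (j : ℕ) :
    Rep.of (signRep k ε j) ⟶ cosetFunctions k ε.ker :=
  Rep.ofHom ⟨{ toFun c := ⟨fun g => ((ε g : ℤ) : k) ^ j * c, fun n h => by
                 change ((ε (n.1 * h) : ℤ) : k) ^ j * c = ((ε h : ℤ) : k) ^ j * c
                 rw [map_mul, n.2, one_mul]⟩
               map_add' _ _ := Subtype.ext (funext fun _ => mul_add _ _ _)
               map_smul' _ _ := Subtype.ext (funext fun _ => mul_left_comm _ _ _) }, fun h => by
    refine LinearMap.ext fun c => Subtype.ext (funext fun g => ?_)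
    change ((ε g : ℤ) : k) ^ j * (((ε h : ℤ) : k) ^ j * c) = ((ε (g * h) : ℤ) : k) ^ j * c
    rw [map_mul, Units.val_mul, Int.cast_mul, mul_pow, mul_assoc]⟩

/-- The projection of the functions on the two cosets of the kernel of `ε` to the part on which
`G` acts through `ε ^ j`. -/
noncomputable def signProjection (k : Type u) [Field k] (ε : G →* ℤˣ) {t : G} (ht : ε t = -1)
    (j : ℕ) : cosetFunctions k ε.ker ⟶ Rep.of (signRep k ε j) :=
  Rep.ofHom ⟨{ toFun f := (f.1 1 + (-1) ^ j * f.1 t) / 2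
               map_add' f g := by
                 change (f.1 _ + g.1 _ + (-1) ^ j * (f.1 _ + g.1 _)) / 2 = _
                 ring
               map_smul' c f := by
                 change (c * f.1 _ + (-1) ^ j * (c * f.1 _)) / 2 = c * _
                 ring }, fun h => by
    refine LinearMap.ext fun f => ?_
    change (f.1 (1 * h) + (-1) ^ j * f.1 (t * h)) / 2 =
      ((ε h : ℤ) : k) ^ j * ((f.1 1 + (-1) ^ j * f.1 t) / 2)
    rw [one_mul]
    rcases Int.units_eq_one_or (ε h) with hh | hh
    · have h1 := cosetFunctions_apply f (MonoidHom.mem_ker.2 hh) 1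
      have h2 := cosetFunctions_apply f
        (show t * h * t⁻¹ ∈ ε.ker by simp [MonoidHom.mem_ker, ht, hh]) t
      rw [mul_one] at h1
      rw [inv_mul_cancel_right] at h2
      rw [h1, h2, hh]
      simp
    · have h1 := cosetFunctions_apply f
        (show h * t⁻¹ ∈ ε.ker by simp [MonoidHom.mem_ker, ht, hh]) t
      have h2 := cosetFunctions_apply f
        (show t * h ∈ ε.ker by simp [MonoidHom.mem_ker, ht, hh]) 1
      rw [inv_mul_cancel_right] at h1
      rw [mul_one] at h2
      rw [h1, h2, hh]
      have h3 : ((-1 : k) ^ j) * (-1) ^ j = 1 := by rw [← mul_pow]; simp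
      simp only [Units.val_neg, Units.val_one, Int.cast_neg, Int.cast_one]
      linear_combination (-f.1 t / 2) * h3⟩

theorem signProjection_signFunctions (ε : G →* ℤˣ) {t : G} (ht : ε t = -1) (i j : ℕ) (c : k) :
    (signProjection k ε ht j).hom ((signFunctions k ε i).hom c) =
      ((1 + (-1) ^ j * (-1) ^ i) / 2) * c := by
  change ((((ε 1 : ℤˣ) : ℤ) : k) ^ i * c + (-1) ^ j * (((ε t : ℤ) : k) ^ i * c)) / 2 = _
  rw [map_one, ht]
  simp
  ring

/-- The induced module of a subgroup of index two is the sum of the trivial and of the sign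
representation, so its cohomology is the sum of theirs. -/
theorem finrank_groupCohomology_add_le [CharZero k] (ε : G →* ℤˣ) {t : G} (ht : ε t = -1) (i : ℕ)
    [Module.Finite k (groupCohomology (Rep.trivial k ε.ker k) i)] :
    (∀ j, Module.Finite k (groupCohomology (Rep.of (signRep k ε j)) i)) ∧
      Module.finrank k (groupCohomology (Rep.of (signRep k ε 0)) i) +
        Module.finrank k (groupCohomology (Rep.of (signRep k ε 1)) i) ≤
      Module.finrank k (groupCohomology (Rep.trivial k ε.ker k) i) := by
  let e := (groupCohomology.coindIso (Rep.trivial k ε.ker k) i).toLinearEquiv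
  have hfin : Module.Finite k (groupCohomology (cosetFunctions k ε.ker) i) :=
    Module.Finite.equiv e.symm
  let F := groupCohomology.functor k G i
  let a (j : ℕ) : groupCohomology (Rep.of (signRep k ε j)) i →ₗ[k]
      groupCohomology (cosetFunctions k ε.ker) i := (F.map (signFunctions k ε j)).hom
  let p (j : ℕ) : groupCohomology (cosetFunctions k ε.ker) i →ₗ[k]
      groupCohomology (Rep.of (signRep k ε j)) i := (F.map (signProjection k ε ht j)).hom
  have hpa : ∀ j v, p j (a j v) = v := fun j v => by
    have h : signFunctions k ε j ≫ signProjection k ε ht j = 𝟙 _ := by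
      refine Rep.hom_ext (DFunLike.ext _ _ fun c => ?_)
      refine (signProjection_signFunctions ε ht j j c).trans ?_
      rw [← mul_pow]
      norm_num
    have h2 : F.map (signFunctions k ε j) ≫ F.map (signProjection k ε ht j) = 𝟙 _ := by
      rw [← F.map_comp, h, F.map_id]
    exact LinearMap.congr_fun (congrArg ModuleCat.Hom.hom h2) v
  have hpa0 : ∀ j l, j + l = 1 → ∀ v, p j (a l v) = 0 := fun j l hjl v => by
    have h : signFunctions k ε l ≫ signProjection k ε ht j = 0 := by
      refine Rep.hom_ext (DFunLike.ext _ _ fun c => ?_)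
      refine (signProjection_signFunctions ε ht l j c).trans ?_
      rw [← pow_add, hjl]
      norm_num
    have h2 : F.map (signFunctions k ε l) ≫ F.map (signProjection k ε ht j) = 0 := by
      rw [← F.map_comp, h]
      change HomologicalComplex.homologyMap (groupCohomology.cochainsMap _ _) _ = 0
      rw [groupCohomology.cochainsMap_zero, HomologicalComplex.homologyMap_zero]
    exact LinearMap.congr_fun (congrArg ModuleCat.Hom.hom h2) v
  have hf : ∀ j, Module.Finite k (groupCohomology (Rep.of (signRep k ε j)) i) := fun j =>
    Module.Finite.of_injective (a j) (Function.LeftInverse.injective (hpa j))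
  have hf0 := hf 0
  have hf1 := hf 1
  refine ⟨hf, ?_⟩
  have hinj : Function.Injective ((a 0).coprod (a 1)) := by
    have : Function.LeftInverse ((p 0).prod (p 1)) ((a 0).coprod (a 1)) := fun v => by
      refine Prod.ext ?_ ?_
      · change p 0 (a 0 v.1 + a 1 v.2) = v.1
        rw [map_add, hpa, hpa0 0 1 rfl, add_zero]
      · change p 1 (a 0 v.1 + a 1 v.2) = v.2
        rw [map_add, hpa, hpa0 1 0 rfl, zero_add]
    exact this.injective
  have h1 := LinearMap.finrank_le_finrank_of_injective hinj
  rw [Module.finrank_prod] at h1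
  exact h1.trans e.finrank_eq.le

end CohomologyBound

/-! ### Antisymmetrization of cochains on a lattice -/

section Antisymmetrization

variable {k : Type*} [Field k] {L : Type*}

/-- The antisymmetrization of a function of `n` variables, as a linear map. -/
noncomputable def antisymmetrize (k : Type*) [Field k] (L : Type*) (n : ℕ) :
    ((Fin n → L) → k) →ₗ[k] (Fin n → L) → k where
  toFun c v := ∑ σ : Equiv.Perm (Fin n), ((Equiv.Perm.sign σ : ℤ) : k) * c (v ∘ σ)
  map_add' c c' := by
    funext v
    simp [mul_add, Finset.sum_add_distrib]
  map_smul' a c := by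
    funext v
    simp [Finset.mul_sum, mul_left_comm]

theorem antisymmetrize_apply {n : ℕ} (c : (Fin n → L) → k) (v : Fin n → L) :
    antisymmetrize k L n c v =
      ∑ σ : Equiv.Perm (Fin n), ((Equiv.Perm.sign σ : ℤ) : k) * c (v ∘ σ) := rfl

theorem antisymmetrize_comp_perm {n : ℕ} (c : (Fin n → L) → k) (τ : Equiv.Perm (Fin n))
    (v : Fin n → L) : antisymmetrize k L n (fun w => c (w ∘ τ)) v =
      ((Equiv.Perm.sign τ : ℤ) : k) * antisymmetrize k L n c v := by
  rw [antisymmetrize_apply, antisymmetrize_apply, Finset.mul_sum]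
  conv_rhs => rw [← Equiv.sum_comp (Equiv.mulRight τ)]
  refine Finset.sum_congr rfl fun σ _ => ?_
  rw [Equiv.coe_mulRight, Equiv.Perm.sign_mul, ← mul_assoc]
  rcases Int.units_eq_one_or (Equiv.Perm.sign τ) with h | h <;> simp [h, Function.comp_assoc]

theorem antisymmetrize_alternatingMap [AddCommGroup L] {n : ℕ} (ω : L [⋀^Fin n]→ₗ[ℤ] k) :
    antisymmetrize k L n ω = (n.factorial : k) • ⇑ω := by
  funext v
  rw [antisymmetrize_apply, Finset.sum_congr rfl fun σ _ => ?_, Finset.sum_const, Finset.card_univ,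
    Fintype.card_perm, Fintype.card_fin, nsmul_eq_mul]
  · rfl
  · have := ω.map_perm v σ
    change ((Equiv.Perm.sign σ : ℤ) : k) * ω (v ∘ σ) = ω v
    rw [show ω (v ∘ σ) = _ from this]
    rcases Int.units_eq_one_or (Equiv.Perm.sign σ) with h | h <;> simp [h]

/-- Antisymmetrization kills the coboundaries of inhomogeneous cochains with trivial
coefficients. -/
theorem antisymmetrize_coboundary [CharZero k] [AddCommGroup L] {n : ℕ} (b : (Fin n → L) → k) :
    antisymmetrize k L (n + 1) (fun v => b (fun i => v i.succ) +
      ∑ j : Fin (n + 1), (-1 : k) ^ ((j : ℕ) + 1) • b (Fin.contractNth j (· + ·) v)) = 0 := by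
  -- the terms that add two adjacent variables are symmetric in these variables
  have h1 : ∀ j : Fin n,
      antisymmetrize k L (n + 1) (fun v => b (Fin.contractNth j.castSucc (· + ·) v)) = 0 := by
    intro j
    have hs : (fun v : Fin (n + 1) → L => b (Fin.contractNth j.castSucc (· + ·) v)) =
        fun v => b (Fin.contractNth j.castSucc (· + ·)
          (v ∘ Equiv.swap j.castSucc j.succ)) := by
      funext v
      congr 1
      funext i
      rcases lt_trichotomy (i : ℕ) (j.castSucc : ℕ) with h | h | h
      · rw [Fin.contractNth_apply_of_lt _ _ _ _ h, Fin.contractNth_apply_of_lt _ _ _ _ h,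
          Function.comp_apply, Equiv.swap_apply_of_ne_of_ne] <;>
        · rw [Ne, Fin.ext_iff]; simp at h ⊢; omega
      · obtain rfl : i = j := Fin.ext h
        rw [Fin.contractNth_apply_of_eq _ _ _ _ h, Fin.contractNth_apply_of_eq _ _ _ _ h,
          Function.comp_apply, Function.comp_apply, Equiv.swap_apply_left,
          Equiv.swap_apply_right, add_comm]
      · rw [Fin.contractNth_apply_of_gt _ _ _ _ h, Fin.contractNth_apply_of_gt _ _ _ _ h,
          Function.comp_apply, Equiv.swap_apply_of_ne_of_ne] <;>
        · rw [Ne, Fin.ext_iff]; simp at h ⊢; omega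
    funext v
    have h2 := antisymmetrize_comp_perm (k := k)
      (fun v => b (Fin.contractNth j.castSucc (· + ·) v)) (Equiv.swap j.castSucc j.succ) v
    rw [← hs, Equiv.Perm.sign_swap (by rw [Ne, Fin.ext_iff]; simp)] at h2
    simp only [Units.val_neg, Units.val_one, Int.cast_neg, Int.cast_one, neg_mul, one_mul] at h2
    exact self_eq_neg.1 h2
  -- the two outer terms differ by a cyclic permutation of the variables
  have h2 : antisymmetrize k L (n + 1) (fun v => b (fun i => v i.succ)) =
      (-1 : k) ^ n • antisymmetrize k L (n + 1)
        (fun v => b (Fin.contractNth (Fin.last n) (· + ·) v)) := by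
    funext v
    rw [Pi.smul_apply, smul_eq_mul]
    have h3 := antisymmetrize_comp_perm (k := k)
      (fun v => b (Fin.contractNth (Fin.last n) (· + ·) v)) (finRotate (n + 1)) v
    rw [sign_finRotate, Nat.add_sub_cancel] at h3
    simp only [Units.val_pow_eq_pow_val, Units.val_neg, Units.val_one, Int.cast_pow, Int.cast_neg,
      Int.cast_one] at h3
    rw [← h3]
    refine congrFun (congrArg _ (funext fun w => congrArg b (funext fun i => ?_))) v
    rw [Fin.contractNth_apply_of_lt _ _ _ _ (by simp), Function.comp_apply, finRotate_apply,
      Fin.coeSucc_eq_succ]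
  have h4 : (fun v : Fin (n + 1) → L => b (fun i => v i.succ) +
      ∑ j : Fin (n + 1), (-1 : k) ^ ((j : ℕ) + 1) • b (Fin.contractNth j (· + ·) v)) =
      (fun v => b (fun i => v i.succ)) + ∑ j : Fin (n + 1), (-1 : k) ^ ((j : ℕ) + 1) •
        fun v => b (Fin.contractNth j (· + ·) v) := by
    funext v
    simp
  rw [h4, map_add, map_sum, Fin.sum_univ_castSucc]
  simp only [map_smul, h1, smul_zero, Finset.sum_const_zero, zero_add, h2, ← add_smul]
  rw [Fin.val_last, pow_succ, mul_neg_one, add_neg_cancel, zero_smul]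

/-- A multilinear map is a cocycle: the sum telescopes. -/
theorem MultilinearMap.coboundary_eq_zero [AddCommGroup L] {n : ℕ}
    (ω : MultilinearMap ℤ (fun _ : Fin n => L) k) (v : Fin (n + 1) → L) :
    ω (fun i => v i.succ) +
      ∑ j : Fin (n + 1), (-1 : k) ^ ((j : ℕ) + 1) • ω (Fin.contractNth j (· + ·) v) = 0 := by
  let R : Fin (n + 1) → k := fun j => ω (v ∘ j.succAbove)
  have h1 : ∀ j : Fin n, ω (Fin.contractNth j.castSucc (· + ·) v) = R j.castSucc + R j.succ := by
    intro j
    have e1 : Fin.contractNth j.castSucc (· + ·) v =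
        Function.update (v ∘ j.succ.succAbove) j (v j.succ + v j.castSucc) := by
      funext i
      rcases lt_trichotomy (i : ℕ) (j.castSucc : ℕ) with h | h | h
      · rw [Fin.contractNth_apply_of_lt _ _ _ _ h, Function.update_of_ne (by
          rw [Ne, Fin.ext_iff]; exact h.ne), Function.comp_apply, Fin.succAbove_of_castSucc_lt]
        rw [Fin.lt_def]; simp at h ⊢; omega
      · obtain rfl : i = j := Fin.ext h
        rw [Fin.contractNth_apply_of_eq _ _ _ _ h, Function.update_self, add_comm]
      · rw [Fin.contractNth_apply_of_gt _ _ _ _ h, Function.update_of_ne (by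
          rw [Ne, Fin.ext_iff]; exact h.ne'), Function.comp_apply, Fin.succAbove_of_le_castSucc]
        rw [Fin.le_def]; simp at h ⊢; omega
    have e2 : Function.update (v ∘ j.succ.succAbove) j (v j.succ) = v ∘ j.castSucc.succAbove := by
      funext i
      rcases lt_trichotomy (i : ℕ) (j : ℕ) with h | h | h
      · rw [Function.update_of_ne (by rw [Ne, Fin.ext_iff]; exact h.ne), Function.comp_apply,
          Function.comp_apply, Fin.succAbove_of_castSucc_lt, Fin.succAbove_of_castSucc_lt] <;>
        · rw [Fin.lt_def]; simp; omega
      · obtain rfl : i = j := Fin.ext h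
        rw [Function.update_self, Function.comp_apply, Fin.succAbove_castSucc_self]
      · rw [Function.update_of_ne (by rw [Ne, Fin.ext_iff]; exact h.ne'), Function.comp_apply,
          Function.comp_apply, Fin.succAbove_of_le_castSucc, Fin.succAbove_of_le_castSucc] <;>
        · rw [Fin.le_def]; simp; omega
    have e3 : Function.update (v ∘ j.succ.succAbove) j (v j.castSucc) = v ∘ j.succ.succAbove := by
      rw [Function.update_eq_self_iff, Function.comp_apply, Fin.succAbove_succ_self]
    rw [e1, ω.map_update_add, e2, e3]
  have h2 : ω (Fin.contractNth (Fin.last n) (· + ·) v) = R (Fin.last n) := by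
    change _ = ω _
    congr 1
    funext i
    rw [Fin.contractNth_apply_of_lt _ _ _ _ (by simp), Function.comp_apply, Fin.succAbove_last]
  have h3 : ω (fun i => v i.succ) = R 0 := rfl
  have h4 := Fin.sum_univ_castSucc fun j : Fin (n + 1) => (-1 : k) ^ (j : ℕ) * R j
  rw [Fin.sum_univ_succ] at h4
  rw [Fin.sum_univ_castSucc, h2, h3]
  simp only [h1, smul_eq_mul, mul_add, Finset.sum_add_distrib, Fin.val_castSucc, Fin.val_last,
    Fin.val_zero, Fin.val_succ, pow_succ, pow_zero, mul_neg_one, neg_mul, Finset.sum_neg_distrib,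
    one_mul] at h4 ⊢
  linear_combination h4

end Antisymmetrization

/-! ### Cohomology of generalized dihedral groups -/

/-- The structure of a semidirect product `L ⋊ {±1}`, in which `-1` acts on the abelian group `L`
by inversion, on a group `Γ`: the sign `Γ → {±1}`, the `L`-component `Γ → L` (a crossed
homomorphism), the inclusion `L → Γ`, and an element of sign `-1`. -/
structure GeneralizedDihedral (Γ L : Type*) [Group Γ] [AddCommGroup L] where
  sgn : Γ →* ℤˣ
  trans : Γ → L
  trans_mul : ∀ g h, trans (g * h) = trans g + sgn g • trans h
  incl : L → Γ
  trans_incl : ∀ l, trans (incl l) = l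
  sgn_incl : ∀ l, sgn (incl l) = 1
  incl_trans : ∀ g, sgn g = 1 → incl (trans g) = g
  reflection : Γ
  sgn_reflection : sgn reflection = -1

namespace GeneralizedDihedral

section Basic

variable {Γ L : Type*} [Group Γ] [AddCommGroup L] (D : GeneralizedDihedral Γ L)

theorem incl_add (a b : L) : D.incl (a + b) = D.incl a * D.incl b := by
  rw [← D.incl_trans (D.incl a * D.incl b) (by rw [map_mul, sgn_incl, sgn_incl, one_mul]),
    trans_mul, trans_incl, trans_incl, sgn_incl, one_smul]

/-- The kernel of the sign is `L`. -/
def kerEquiv : D.sgn.ker ≃* Multiplicative L where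
  toFun g := Multiplicative.ofAdd (D.trans g)
  invFun l := ⟨D.incl l.toAdd, D.sgn_incl _⟩
  left_inv g := Subtype.ext (D.incl_trans g g.2)
  right_inv l := congrArg Multiplicative.ofAdd (D.trans_incl _)
  map_mul' g h := by
    change Multiplicative.ofAdd (D.trans (g.1 * h.1)) = _
    rw [trans_mul, show D.sgn g.1 = 1 from g.2, one_smul]
    rfl

/-- The successive differences of the `L`-components of `1, g₀, g₀ g₁, …`. -/
def steps {n : ℕ} (g : Fin n → Γ) (i : Fin n) : L :=
  D.sgn (Fin.partialProd g i.castSucc) • D.trans (g i)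

theorem steps_succ {n : ℕ} (g : Fin (n + 1) → Γ) (i : Fin n) :
    D.steps g i.succ = D.sgn (g 0) • D.steps (fun j => g j.succ) i := by
  rw [steps, steps, Fin.castSucc_succ, Fin.partialProd_succ', map_mul, mul_smul]
  rfl

theorem steps_contractNth {n : ℕ} (j : Fin (n + 1)) (g : Fin (n + 1) → Γ) :
    D.steps (Fin.contractNth j (· * ·) g) = Fin.contractNth j (· + ·) (D.steps g) := by
  funext i
  rw [steps, Fin.partialProd_contractNth, Function.comp_apply]
  rcases lt_trichotomy (i : ℕ) (j : ℕ) with h | h | h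
  · rw [Fin.contractNth_apply_of_lt _ _ _ _ h, Fin.contractNth_apply_of_lt _ _ _ _ h, steps,
      Fin.succAbove_of_castSucc_lt]
    rw [Fin.lt_def]; simp; omega
  · rw [Fin.contractNth_apply_of_eq _ _ _ _ h, Fin.contractNth_apply_of_eq _ _ _ _ h, steps, steps,
      Fin.succAbove_of_castSucc_lt, trans_mul, smul_add, smul_smul, ← map_mul,
      Fin.castSucc_succ, Fin.partialProd_succ]
    rw [Fin.lt_def]; simp; omega
  · rw [Fin.contractNth_apply_of_gt _ _ _ _ h, Fin.contractNth_apply_of_gt _ _ _ _ h, steps,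
      Fin.succAbove_of_le_castSucc, Fin.castSucc_succ]
    rw [Fin.le_def]; simp; omega

theorem steps_incl {n : ℕ} (v : Fin n → L) : D.steps (fun i => D.incl (v i)) = v := by
  funext i
  have h : ∀ j : Fin (n + 1), D.sgn (Fin.partialProd (fun i => D.incl (v i)) j) = 1 := fun j => by
    induction j using Fin.induction with
    | zero => rw [Fin.partialProd_zero, map_one]
    | succ j ih => rw [Fin.partialProd_succ, map_mul, ih, sgn_incl, one_mul]
  rw [steps, h, one_smul, trans_incl]

end Basic

section Cohomology

universe u

open CategoryTheory groupCohomology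

variable {k : Type u} [Field k] {Γ : Type u} {L : Type} [Group Γ] [AddCommGroup L]
  (D : GeneralizedDihedral Γ L) (ρ : Representation k Γ k)

/-- Restriction of a cochain to `L`, followed by antisymmetrization. -/
noncomputable def cochainToForm (i : ℕ) :
    (inhomogeneousCochains (Rep.of ρ)).X i ⟶ ModuleCat.of k ((Fin i → L) → k) :=
  ModuleCat.ofHom (antisymmetrize k L i ∘ₗ LinearMap.funLeft k k fun v r => D.incl (v r))

theorem cochainToForm_apply (i : ℕ) (c : (Fin i → Γ) → k) :
    D.cochainToForm ρ i c = antisymmetrize k L i fun v => c fun r => D.incl (v r) := rfl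

variable {ρ}

theorem d_comp_cochainToForm [CharZero k] (hρ : ∀ l c, ρ (D.incl l) c = c) (i : ℕ) :
    (inhomogeneousCochains (Rep.of ρ)).d ((ComplexShape.up ℕ).prev i) i ≫
      D.cochainToForm ρ i = 0 := by
  cases i with
  | zero => rw [HomologicalComplex.shape _ _ _ (by simp), Limits.zero_comp]
  | succ n =>
    rw [CochainComplex.prev_nat_succ, inhomogeneousCochains.d_def]
    refine ModuleCat.hom_ext (LinearMap.ext fun b => ?_)
    change D.cochainToForm ρ (n + 1) _ = 0
    rw [cochainToForm_apply, ← antisymmetrize_coboundary (k := k) fun v =>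
      (b : (Fin n → Γ) → k) fun r => D.incl (v r)]
    congr 1
    funext v
    refine (inhomogeneousCochains.d_hom_apply _ _ _ _).trans ?_
    refine congrArg₂ _ (hρ _ _) (Finset.sum_congr rfl fun r _ => ?_)
    congr 2
    exact (Fin.comp_contractNth (· + ·) (· * ·) D.incl_add r v).symm

/-- A cohomology class gives an alternating form on `L`: restrict a cocycle to `L` and
antisymmetrize. -/
noncomputable def toForm [CharZero k] (hρ : ∀ l c, ρ (D.incl l) c = c) (i : ℕ) :
    groupCohomology (Rep.of ρ) i →ₗ[k] (Fin i → L) → k :=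
  (HomologicalComplex.homologyι _ i ≫ HomologicalComplex.descOpcycles _ (D.cochainToForm ρ i)
    _ rfl (D.d_comp_cochainToForm hρ i)).hom

/-- `toForm` turns pull-back along an endomorphism of `Γ` that preserves `L` into pull-back of
forms. -/
theorem toForm_map [CharZero k] (hρ : ∀ l c, ρ (D.incl l) c = c) (i : ℕ) (κ : Γ →* Γ)
    (φ : Rep.res κ (Rep.of ρ) ⟶ Rep.of ρ) (hφ : ∀ c : k, φ.hom c = c) (m : L → L)
    (hm : ∀ l, κ (D.incl l) = D.incl (m l)) (c : groupCohomology (Rep.of ρ) i) (v : Fin i → L) :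
    D.toForm hρ i (groupCohomology.map κ φ i c) v = D.toForm hρ i c (m ∘ v) := by
  let P : ModuleCat.of k ((Fin i → L) → k) ⟶ ModuleCat.of k ((Fin i → L) → k) :=
    ModuleCat.ofHom (LinearMap.funLeft k k fun v => m ∘ v)
  have h0 : (cochainsMap κ φ).f i ≫ D.cochainToForm ρ i = D.cochainToForm ρ i ≫ P := by
    refine ModuleCat.hom_ext (LinearMap.ext fun c => funext fun v => ?_)
    change antisymmetrize k L i (fun v => φ.hom (c (κ ∘ fun r => D.incl (v r)))) v =
      antisymmetrize k L i (fun v => c fun r => D.incl (v r)) (m ∘ v)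
    rw [antisymmetrize_apply, antisymmetrize_apply]
    refine Finset.sum_congr rfl fun σ _ => congrArg _ ((hφ _).trans (congrArg c ?_))
    exact funext fun r => hm _
  have h : HomologicalComplex.homologyMap (cochainsMap κ φ) i ≫
      (HomologicalComplex.homologyι (inhomogeneousCochains (Rep.of ρ)) i ≫
      HomologicalComplex.descOpcycles _ (D.cochainToForm ρ i) _ rfl
        (D.d_comp_cochainToForm hρ i)) = (HomologicalComplex.homologyι _ i ≫
      HomologicalComplex.descOpcycles _ (D.cochainToForm ρ i) _ rfl
        (D.d_comp_cochainToForm hρ i)) ≫ P := by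
    rw [HomologicalComplex.homologyι_naturality_assoc,
      HomologicalComplex.opcyclesMap_comp_descOpcycles, Category.assoc,
      HomologicalComplex.descOpcycles_comp]
    congr 2
  exact congrFun (LinearMap.congr_fun (congrArg ModuleCat.Hom.hom h) c) v

variable (ρ)

/-- An alternating form on `L` as a cochain: the value of the form on the edge vectors of the
path `1, g₀, g₀ g₁, …`. -/
noncomputable def formToCochain (i : ℕ) : ModuleCat.of k (L [⋀^Fin i]→ₗ[ℤ] k) ⟶
    (inhomogeneousCochains (Rep.of ρ)).X i :=
  ModuleCat.ofHom
    { toFun ω := fun g => ω (D.steps g)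
      map_add' _ _ := rfl
      map_smul' _ _ := rfl }

variable {ρ} {i : ℕ}

/-- An element of sign `-1` reverses the edge vectors, so the form is an invariant cochain with
coefficients in the `i`-th power of the sign. -/
theorem formToCochain_comp_d (hρ : ∀ g c, ρ g c = ((D.sgn g : ℤ) : k) ^ i * c) :
    D.formToCochain ρ i ≫ (inhomogeneousCochains (Rep.of ρ)).d i (i + 1) = 0 := by
  rw [inhomogeneousCochains.d_def]
  refine ModuleCat.hom_ext (LinearMap.ext fun ω => funext fun g => ?_)
  refine Eq.trans ?_ (MultilinearMap.coboundary_eq_zero (k := k) ω.toMultilinearMap (D.steps g))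
  refine (inhomogeneousCochains.d_hom_apply _ _ _ _).trans ?_
  refine congrArg₂ _ ((hρ _ _).trans ?_) (Finset.sum_congr rfl fun r _ => ?_)
  · change ((D.sgn (g 0) : ℤ) : k) ^ i * ω (D.steps fun r => g r.succ) =
      ω (fun r => D.steps g r.succ)
    have h1 : (fun r => D.steps g r.succ) =
        fun r => ((D.sgn (g 0) : ℤ)) • D.steps (fun r => g r.succ) r :=
      funext fun r => D.steps_succ g r
    rw [h1]
    have h2 := ω.toMultilinearMap.map_smul_univ (fun _ => (D.sgn (g 0) : ℤ))
      (D.steps fun r => g r.succ)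
    refine Eq.trans ?_ h2.symm
    simp
  · exact congrArg (fun w => (-1 : k) ^ ((r : ℕ) + 1) • ω w) (D.steps_contractNth r g)

/-- The cohomology class of an alternating form on `L`. -/
noncomputable def ofForm (hρ : ∀ g c, ρ g c = ((D.sgn g : ℤ) : k) ^ i * c) :
    (L [⋀^Fin i]→ₗ[ℤ] k) →ₗ[k] groupCohomology (Rep.of ρ) i :=
  (HomologicalComplex.liftCycles _ (D.formToCochain ρ i) (i + 1) (by simp)
    (D.formToCochain_comp_d hρ) ≫ HomologicalComplex.homologyπ _ i).hom

theorem toForm_ofForm [CharZero k] (hρ : ∀ g c, ρ g c = ((D.sgn g : ℤ) : k) ^ i * c)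
    (hρ' : ∀ l c, ρ (D.incl l) c = c) (ω : L [⋀^Fin i]→ₗ[ℤ] k) :
    D.toForm hρ' i (D.ofForm hρ ω) = (i.factorial : k) • ⇑ω := by
  have h : (HomologicalComplex.liftCycles _ (D.formToCochain ρ i) (i + 1) (by simp)
      (D.formToCochain_comp_d hρ) ≫ HomologicalComplex.homologyπ _ i) ≫
      (HomologicalComplex.homologyι _ i ≫ HomologicalComplex.descOpcycles _
        (D.cochainToForm ρ i) _ rfl (D.d_comp_cochainToForm hρ' i)) =
      D.formToCochain ρ i ≫ D.cochainToForm ρ i := by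
    simp
  have h2 := LinearMap.congr_fun (congrArg ModuleCat.Hom.hom h) ω
  refine h2.trans ?_
  refine Eq.trans ?_ (antisymmetrize_alternatingMap ω)
  refine (D.cochainToForm_apply ρ i _).trans (congrArg _ (funext fun v => ?_))
  exact congrArg ω (D.steps_incl v)

theorem ofForm_injective [CharZero k] (hρ : ∀ g c, ρ g c = ((D.sgn g : ℤ) : k) ^ i * c) :
    Function.Injective (D.ofForm hρ) := fun ω ω' h => by
  have hρ' : ∀ l c, ρ (D.incl l) c = c := fun l c => by rw [hρ, sgn_incl]; simp
  have h1 := congrArg (D.toForm hρ' i) h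
  rw [toForm_ofForm, toForm_ofForm] at h1
  exact DFunLike.coe_injective
    (smul_right_injective _ (Nat.cast_ne_zero.2 i.factorial_ne_zero) h1)

end Cohomology

end GeneralizedDihedral

/-! ### The dimension count -/

section AlternatingForms

/-- The pull-back of a `k`-linear alternating form along an additive map from a lattice. -/
def AlternatingMap.pullbackInt {k V L ι : Type*} [CommRing k] [AddCommGroup V] [Module k V]
    [AddCommGroup L] (f : L →ₗ[ℤ] V) : (V [⋀^ι]→ₗ[k] k) →ₗ[k] (L [⋀^ι]→ₗ[ℤ] k) where
  toFun ω :=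
    { (ω.toMultilinearMap.restrictScalars ℤ).compLinearMap fun _ => f with
      map_eq_zero_of_eq' := fun v _ _ hv hij =>
        ω.map_eq_zero_of_eq (fun i => f (v i)) (congrArg f hv) hij }
  map_add' _ _ := rfl
  map_smul' _ _ := rfl

theorem AlternatingMap.pullbackInt_apply {k V L ι : Type*} [CommRing k] [AddCommGroup V]
    [Module k V] [AddCommGroup L] (f : L →ₗ[ℤ] V) (ω : V [⋀^ι]→ₗ[k] k) (v : ι → L) :
    AlternatingMap.pullbackInt f ω v = ω fun i => f (v i) := rfl

/-- There are enough alternating forms on a lattice, since a form on `kⁿ` is determined by its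
restriction to `ℤⁿ`. -/
theorem choose_le_finrank_alternatingMap (k : Type*) [Field k] [CharZero k] {L : Type*}
    [AddCommGroup L] {n : ℕ} (e : L ≃ₗ[ℤ] (Fin n → ℤ)) (i : ℕ)
    [Module.Finite k (L [⋀^Fin i]→ₗ[ℤ] k)] :
    n.choose i ≤ Module.finrank k (L [⋀^Fin i]→ₗ[ℤ] k) := by
  let f : L →ₗ[ℤ] (Fin n → k) := (LinearMap.compLeft (Int.castAddHom k).toIntLinearMap _) ∘ₗ
    e.toLinearMap
  let F := AlternatingMap.pullbackInt (k := k) (ι := Fin i) f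
  have hF : Function.Injective F := fun ω ω' h => by
    refine Module.Basis.ext_alternating (Pi.basisFun k (Fin n)) fun v _ => ?_
    have h1 := DFunLike.congr_fun h fun j => e.symm (Pi.single (v j) 1)
    have h2 : (fun j => f (e.symm (Pi.single (v j) 1))) =
        fun j => Pi.basisFun k (Fin n) (v j) := by
      funext j
      ext l
      simp [f, Pi.single_apply, apply_ite (Int.cast : ℤ → k)]
    have h3 : ∀ ω : (Fin n → k) [⋀^Fin i]→ₗ[k] k,
        F ω (fun j => e.symm (Pi.single (v j) 1)) =
          ω fun j => Pi.basisFun k (Fin n) (v j) := fun ω => congrArg ω h2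
    rwa [h3, h3] at h1
  refine le_of_eq_of_le ?_ (LinearMap.finrank_le_finrank_of_injective hF)
  rw [exteriorPower.alternatingMapLinearEquiv.finrank_eq, Module.finrank_linearMap_self,
    exteriorPower.finrank_eq, Module.finrank_fin_fun]

end AlternatingForms

namespace GeneralizedDihedral

universe u

variable (k : Type u) [Field k] {Γ : Type u} {L : Type} [Group Γ] [AddCommGroup L]

/-- The cohomology of `L` is too small to leave room for anything but the classes of alternating
forms in `H^i(Γ, ε^i)`, or for anything at all in `H^i(Γ, ε^(i+1))`. -/
theorem finrank_groupCohomology [CharZero k] (D : GeneralizedDihedral Γ L) {n : ℕ}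
    (e : L ≃ₗ[ℤ] (Fin n → ℤ))
    (i : ℕ) :
    (∀ j, Module.Finite k (groupCohomology (Rep.of (signRep k D.sgn j)) i)) ∧
    Module.finrank k (groupCohomology (Rep.of (signRep k D.sgn i)) i) = n.choose i ∧
    Module.finrank k (groupCohomology (Rep.of (signRep k D.sgn (i + 1))) i) = 0 ∧
    Module.finrank k (L [⋀^Fin i]→ₗ[ℤ] k) = n.choose i := by
  obtain ⟨hf, hle⟩ := finrank_groupCohomology_le_choose (k := k) n D.sgn.ker
    (D.kerEquiv.trans (AddEquiv.toMultiplicative e.toAddEquiv)) i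
  obtain ⟨hfin, hadd⟩ := finrank_groupCohomology_add_le (k := k) D.sgn D.sgn_reflection i
  have hfi := hfin i
  have hinj := D.ofForm_injective (i := i) (signRep_apply (k := k) D.sgn i)
  have hW : Module.Finite k (L [⋀^Fin i]→ₗ[ℤ] k) := Module.Finite.of_injective _ hinj
  have h1 := choose_le_finrank_alternatingMap k e i
  have h2 := LinearMap.finrank_le_finrank_of_injective hinj
  refine ⟨hfin, ?_⟩
  clear hinj hfi
  rcases Nat.even_or_odd i with hi | hi
  · rw [signRep_odd D.sgn hi.add_one]
    rw [signRep_even D.sgn hi, ← signRep_even D.sgn Even.zero] at h2 ⊢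
    omega
  · rw [signRep_even D.sgn hi.add_one, ← signRep_even D.sgn Even.zero]
    rw [signRep_odd D.sgn hi] at h2 ⊢
    omega

theorem subsingleton_of_odd [CharZero k] (D : GeneralizedDihedral Γ L) {n : ℕ}
    (e : L ≃ₗ[ℤ] (Fin n → ℤ))
    {i : ℕ} (hi : Odd i) : Subsingleton (groupCohomology (Rep.trivial k Γ k) i) := by
  obtain ⟨hf, -, h, -⟩ := D.finrank_groupCohomology k e i
  have := hf (i + 1)
  rw [signRep_even D.sgn hi.add_one] at h this
  exact Module.finrank_zero_iff.1 h

theorem finrank_of_even [CharZero k] (D : GeneralizedDihedral Γ L) {n : ℕ}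
    (e : L ≃ₗ[ℤ] (Fin n → ℤ))
    {i : ℕ} (hi : Even i) : Module.Finite k (groupCohomology (Rep.trivial k Γ k) i) ∧
      Module.finrank k (groupCohomology (Rep.trivial k Γ k) i) = n.choose i := by
  obtain ⟨hf, h, -⟩ := D.finrank_groupCohomology k e i
  have := hf i
  rw [signRep_even D.sgn hi] at h this
  exact ⟨this, h⟩

variable {k}

theorem trivial_eq_sgn_pow (D : GeneralizedDihedral Γ L) {i : ℕ} (hi : Even i) (g : Γ) (c : k) :
    Representation.trivial k Γ k g c = ((D.sgn g : ℤ) : k) ^ i * c := by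
  rw [← signRep_even D.sgn hi, signRep_apply]

variable (k)

/-- In even degrees, the cohomology of `Γ` with trivial coefficients is the space of alternating
forms on `L`. -/
noncomputable def formEquiv [CharZero k] (D : GeneralizedDihedral Γ L) {n : ℕ}
    (e : L ≃ₗ[ℤ] (Fin n → ℤ))
    {i : ℕ} (hi : Even i) :
    (L [⋀^Fin i]→ₗ[ℤ] k) ≃ₗ[k] groupCohomology (Rep.trivial k Γ k) i :=
  LinearEquiv.ofBijective (D.ofForm (D.trivial_eq_sgn_pow hi)) <| by
    obtain ⟨-, -, -, h⟩ := D.finrank_groupCohomology k e i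
    obtain ⟨hf, h'⟩ := D.finrank_of_even k e hi
    have hinj := D.ofForm_injective (i := i) (D.trivial_eq_sgn_pow (k := k) hi)
    have hW : Module.Finite k (L [⋀^Fin i]→ₗ[ℤ] k) := Module.Finite.of_injective _ hinj
    exact ⟨hinj,
      (LinearMap.injective_iff_surjective_of_finrank_eq_finrank (h.trans h'.symm)).1 hinj⟩

/-- Under `formEquiv`, pull-back along an endomorphism of `Γ` that preserves `L` is pull-back of
forms. -/
theorem map_formEquiv [CharZero k] (D : GeneralizedDihedral Γ L) {n : ℕ}
    (e : L ≃ₗ[ℤ] (Fin n → ℤ))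
    {i : ℕ} (hi : Even i) (κ : Γ →* Γ)
    (φ : Rep.res κ (Rep.trivial k Γ k) ⟶ Rep.trivial k Γ k) (hφ : ∀ c : k, φ.hom c = c)
    (m : L →ₗ[ℤ] L) (hm : ∀ l, κ (D.incl l) = D.incl (m l)) (ω : L [⋀^Fin i]→ₗ[ℤ] k) :
    groupCohomology.map κ φ i (D.formEquiv k e hi ω) = D.formEquiv k e hi (ω.compLinearMap m) := by
  have hρ : ∀ l c, Representation.trivial k Γ k (D.incl l) c = c := fun _ _ => rfl
  have h : ∀ ω, D.toForm hρ i (D.formEquiv k e hi ω) = (i.factorial : k) • ⇑ω :=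
    D.toForm_ofForm (D.trivial_eq_sgn_pow hi) hρ
  obtain ⟨ω', hω'⟩ := (D.formEquiv k e hi).surjective
    (groupCohomology.map κ φ i (D.formEquiv k e hi ω))
  rw [← hω']
  refine congrArg _ (DFunLike.coe_injective
    (smul_right_injective _ (Nat.cast_ne_zero.2 i.factorial_ne_zero : (i.factorial : k) ≠ 0) ?_))
  change (i.factorial : k) • ⇑ω' = (i.factorial : k) • ⇑(ω.compLinearMap m)
  rw [← h ω', hω']
  funext v
  rw [D.toForm_map hρ i κ φ hφ m hm, h]
  rfl

end GeneralizedDihedral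

/-! ### Alternating forms and sums over permutations -/

section AlternatingSums

open Equiv

/-- Subtracting the same vector from all the arguments of an alternating map: of the expansion,
only the terms in which that vector occurs at most once survive. -/
theorem AlternatingMap.map_sub_const {R V N ι : Type*} [CommRing R] [AddCommGroup V] [Module R V]
    [AddCommGroup N] [Module R N] [Fintype ι] [DecidableEq ι] (ω : V [⋀^ι]→ₗ[R] N) (v : ι → V)
    (c : V) :
    ω (fun r => v r - c) = ω v - ∑ q, ω (Function.update v q c) := by
  suffices h : ∀ (S : Finset ι) (v : ι → V),
      ω (fun r => if r ∈ S then v r - c else v r) =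
        ω v - ∑ q ∈ S, ω (Function.update v q c) by
    simpa using h Finset.univ v
  intro S
  induction S using Finset.induction_on with
  | empty => intro v; simp
  | insert a S ha ih =>
    intro v
    have h1 : (fun r => if r ∈ insert a S then v r - c else v r) =
        Function.update (fun r => if r ∈ S then v r - c else v r) a (v a - c) := by
      funext r
      by_cases hr : r = a
      · subst hr; simp
      · simp [hr]
    have h2 : Function.update (fun r => if r ∈ S then v r - c else v r) a (v a) =
        fun r => if r ∈ S then v r - c else v r := by
      rw [Function.update_eq_self_iff]; simp [ha]
    have h3 : Function.update (fun r => if r ∈ S then v r - c else v r) a c =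
        fun r => if r ∈ S then Function.update v a c r - c else Function.update v a c r := by
      funext r
      by_cases hr : r = a
      · subst hr; simp [ha]
      · simp [hr]
    have h4 : ∑ q ∈ S, ω (Function.update (Function.update v a c) q c) = 0 :=
      Finset.sum_eq_zero fun q hq => by
        have hqa : a ≠ q := fun h => ha (h ▸ hq)
        exact ω.map_eq_zero_of_eq _ (i := a) (j := q) (by simp [hqa]) hqa
    rw [h1, ω.map_update_sub, h2, h3, ih, ih, Finset.sum_insert ha, h4]
    abel

/-- Summing an alternating map over all the ways of filling its `i` slots from `i + 1` vectors, with
signs, gives a multiple of its value on differences. -/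
theorem AlternatingMap.sum_sign_comp_succ {k V : Type*} [Field k] [AddCommGroup V] {i : ℕ}
    (ω : V [⋀^Fin i]→ₗ[ℤ] k) (f : Fin (i + 1) → V) :
    ∑ τ : Perm (Fin (i + 1)), ((Perm.sign τ : ℤ) : k) * ω (fun r => f (τ r.succ)) =
      (i.factorial : k) * ω fun r => f r.succ - f 0 := by
  have key : ∀ (p : Fin (i + 1)), ∑ e : Perm (Fin i),
      ((Perm.sign (Perm.decomposeFin.symm (p, e)) : ℤ) : k) *
        ω (fun r => f (Perm.decomposeFin.symm (p, e) r.succ)) =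
      (i.factorial : k) * ((if p = 0 then 1 else -1) * ω fun r => f (swap 0 p r.succ)) := by
    intro p
    rw [Finset.sum_congr rfl fun e _ => ?_, Finset.sum_const, Finset.card_univ,
      Fintype.card_perm, Fintype.card_fin, nsmul_eq_mul]
    have h := ω.map_perm (fun r => f (swap 0 p r.succ)) e
    have h' : (fun r => f (Perm.decomposeFin.symm (p, e) r.succ)) =
        (fun r => f (swap 0 p r.succ)) ∘ e := by
      funext r
      rw [Perm.decomposeFin_symm_apply_succ]
      rfl
    rw [Perm.decomposeFin.symm_sign, h', h]
    rcases Int.units_eq_one_or (Perm.sign e) with h1 | h1 <;> split_ifs <;> simp [h1]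
  rw [← Perm.decomposeFin.symm.sum_comp, Fintype.sum_prod_type,
    Finset.sum_congr rfl fun p _ => key p, ← Finset.mul_sum, Fin.sum_univ_succ,
    ω.map_sub_const]
  simp only [swap_self, refl_apply, if_true, one_mul, Fin.succ_ne_zero, if_false, neg_one_mul,
    Finset.sum_neg_distrib, sub_eq_add_neg]
  refine congrArg (fun t => (i.factorial : k) * (_ + -t)) (Finset.sum_congr rfl fun q _ => ?_)
  refine congrArg ω (funext fun r => ?_)
  by_cases hr : r = q
  · subst hr; simp
  · rw [swap_apply_of_ne_of_ne (Fin.succ_ne_zero r) (by simpa using hr)]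
    simp [hr]

/-- The permutations supported on the range of an embedding are those which are induced from the
source. -/
theorem Equiv.Perm.sum_filter_fixing_compl_range {α β M : Type*} [Fintype α] [DecidableEq α]
    [Fintype β] [DecidableEq β] [AddCommMonoid M] (y : α ↪ β)
    [DecidablePred fun q : Perm β => ∀ b ∉ Set.range y, q b = b] (F : Perm β → M) :
    ∑ q : Perm β with ∀ b ∉ Set.range y, q b = b, F q =
      ∑ τ : Perm α, F (τ.viaFintypeEmbedding y) := by
  refine (Finset.sum_bij (fun τ _ => τ.viaFintypeEmbedding y) (fun τ _ => ?_) (fun τ _ τ' _ h => ?_)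
    (fun q hq => ?_) fun τ _ => rfl).symm
  · exact Finset.mem_filter.2 ⟨Finset.mem_univ _,
      fun b hb => Perm.viaFintypeEmbedding_apply_notMem_range τ y hb⟩
  · ext a
    have := DFunLike.congr_fun h (y a)
    simpa using this
  · have hq := (Finset.mem_filter.1 hq).2
    have hr : ∀ a, q (y a) ∈ Set.range y := fun a => by
      by_contra hn
      exact hn ⟨a, (q.injective (hq _ hn)).symm⟩
    choose g hg using hr
    have hinj : Function.Injective g := fun a a' h => y.injective <| q.injective <| by
      rw [← hg, ← hg, h]
    refine ⟨Equiv.ofBijective g (Finite.injective_iff_bijective.1 hinj), Finset.mem_univ _, ?_⟩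
    ext b
    by_cases hb : b ∈ Set.range y
    · obtain ⟨a, rfl⟩ := hb
      rw [Perm.viaFintypeEmbedding_apply_image]
      exact hg a
    · rw [Perm.viaFintypeEmbedding_apply_notMem_range _ _ hb, hq b hb]

end AlternatingSums

/-! ### Elements of the group algebra of a finite group -/

section GroupAlgebra

variable {k G : Type*} [Field k] [Group G] [Fintype G]

/-- The element of the group algebra with given coefficients. -/
noncomputable def groupSum (k G : Type*) [Field k] [Group G] [Fintype G] :
    (G → k) →ₗ[k] MonoidAlgebra k G where
  toFun f := ∑ g, f g • MonoidAlgebra.of k G g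
  map_add' f f' := by simp [add_smul, Finset.sum_add_distrib]
  map_smul' c f := by simp [mul_smul, Finset.smul_sum]

theorem groupSum_apply (f : G → k) : groupSum k G f = ∑ g, f g • MonoidAlgebra.of k G g := rfl

theorem groupSum_injective : Function.Injective (groupSum k G) := by
  classical
  refine (injective_iff_map_eq_zero _).2 fun f hf => funext fun h => ?_
  have := congrArg (fun x => x.coeff h) hf
  simpa [groupSum_apply, MonoidAlgebra.coeff_sum, Finsupp.single_apply] using this

theorem of_mul_groupSum (h : G) (f : G → k) :
    MonoidAlgebra.of k G h * groupSum k G f = groupSum k G fun g => f (h⁻¹ * g) := by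
  rw [groupSum_apply, groupSum_apply, Finset.mul_sum]
  conv_rhs => rw [← Equiv.sum_comp (Equiv.mulLeft h)]
  refine Finset.sum_congr rfl fun g _ => ?_
  rw [mul_smul_comm, ← map_mul, Equiv.coe_mulLeft, inv_mul_cancel_left]

theorem groupSum_mul_sum (f c : G → k) (C : Finset G) :
    groupSum k G f * ∑ q ∈ C, c q • MonoidAlgebra.of k G q =
      groupSum k G fun g => ∑ q ∈ C, c q * f (g * q⁻¹) := by
  rw [groupSum_apply, groupSum_apply, Finset.mul_sum]
  simp_rw [Finset.sum_smul]
  rw [Finset.sum_comm]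
  refine Finset.sum_congr rfl fun q _ => ?_
  rw [Finset.sum_mul]
  conv_rhs => rw [← Equiv.sum_comp (Equiv.mulRight q)]
  refine Finset.sum_congr rfl fun g _ => ?_
  rw [Equiv.coe_mulRight, mul_inv_cancel_right, smul_mul_smul_comm, ← map_mul, mul_comm]

end GroupAlgebra

/-! ### Alternating forms on the winding lattice and hook symmetrizers -/

namespace WindingLattice

/-- The class of the `a`-th standard basis vector in the winding lattice. -/
def gen {s : ℕ} (a : Fin s) : WindingLattice s := Submodule.Quotient.mk (Pi.single a 1)

theorem perm_gen {s : ℕ} (σ : Equiv.Perm (Fin s)) (a : Fin s) :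
    perm s σ (gen a) = gen (σ a) := by
  refine (perm_mk σ _).trans (congrArg _ (funext fun b => ?_))
  simp only [Function.comp_apply, Pi.single_apply, Equiv.Perm.inv_def, Equiv.symm_apply_eq]

theorem sum_gen (s : ℕ) : ∑ a : Fin s, gen a = 0 := by
  have h : ∑ a : Fin s, gen a = (Submodule.Quotient.mk 1 : WindingLattice s) := 
    (map_sum (Submodule.mkQ (Submodule.span ℤ {(1 : Fin s → ℤ)})) _ _).symm.trans
      (congrArg Submodule.Quotient.mk (Finset.univ_sum_single (1 : Fin s → ℤ)))
  rw [h, Submodule.Quotient.mk_eq_zero]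
  exact Submodule.subset_span rfl

variable {k : Type*} [Field k] {s i : ℕ}

/-- A form on the winding lattice is determined by its values on the generators. -/
theorem form_ext {ω ω' : WindingLattice s [⋀^Fin i]→ₗ[ℤ] k}
    (h : ∀ w : Fin i → Fin s, ω (fun r => gen (w r)) = ω' fun r => gen (w r)) : ω = ω' := by
  let π := Submodule.mkQ (Submodule.span ℤ {(1 : Fin s → ℤ)})
  have key : ω.compLinearMap π = ω'.compLinearMap π := by
    refine Module.Basis.ext_alternating (Pi.basisFun ℤ (Fin s)) fun v _ => ?_
    have := h v
    simp only [gen] at this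
    simpa [π] using this
  ext v
  choose n hn using fun r => Submodule.mkQ_surjective _ (v r)
  have := DFunLike.congr_fun key n
  have hv : (fun r => π (n r)) = v := funext hn
  rw [← hv]
  exact this

variable (k s i) in
/-- The representation of the symmetric group on the alternating forms on the winding lattice. -/
noncomputable def formRep :
    Representation k (Equiv.Perm (Fin s)) (WindingLattice s [⋀^Fin i]→ₗ[ℤ] k) where
  toFun σ :=
    { toFun := fun ω => ω.compLinearMap (perm s σ⁻¹)
      map_add' := fun _ _ => rfl
      map_smul' := fun _ _ => rfl }
  map_one' := by
    refine LinearMap.ext fun ω => ?_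
    change ω.compLinearMap (perm s 1⁻¹) = ω
    rw [inv_one, map_one]
    rfl
  map_mul' σ τ := by
    refine LinearMap.ext fun ω => ?_
    change ω.compLinearMap (perm s (σ * τ)⁻¹) =
      (ω.compLinearMap (perm s τ⁻¹)).compLinearMap (perm s σ⁻¹)
    rw [mul_inv_rev, map_mul]
    rfl

theorem formRep_apply (σ : Equiv.Perm (Fin s)) (ω : WindingLattice s [⋀^Fin i]→ₗ[ℤ] k) :
    formRep k s i σ ω = ω.compLinearMap (perm s σ⁻¹) := rfl

/-- The linear map from the winding lattice to `k^s` that makes the coordinates sum to zero, by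
subtracting the mean. -/
noncomputable def toCentered (k : Type*) [Field k] [CharZero k] (s : ℕ) :
    WindingLattice s →ₗ[ℤ] (Fin s → k) :=
  Submodule.liftQ _
    { toFun := fun n a => (n a : k) - (∑ b, (n b : k)) / s
      map_add' := fun n m => by
        funext a
        simp only [Pi.add_apply, Int.cast_add, Finset.sum_add_distrib]
        ring
      map_smul' := fun c n => by
        funext a
        simp only [Pi.smul_apply, smul_eq_mul, Int.cast_mul, ← Finset.mul_sum, eq_intCast,
          Int.cast_id, zsmul_eq_mul]
        ring }
    (by
      rw [Submodule.span_singleton_le_iff_mem]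
      refine funext fun a => ?_
      have : (s : k) ≠ 0 := Nat.cast_ne_zero.2 (Fin.pos a).ne'
      simp [this])

theorem toCentered_gen_sub (k : Type*) [Field k] [CharZero k] (a b : Fin s) :
    toCentered k s (gen a - gen b) = Pi.single a 1 - Pi.single b 1 := by
  have h : ∀ a : Fin s, toCentered k s (gen a) = Pi.single a 1 - fun _ => (1 : k) / s := by
    intro a
    funext c
    change ((Pi.single a 1 : Fin s → ℤ) c : k) - (∑ b, ((Pi.single a 1 : Fin s → ℤ) b : k)) / s = _
    simp [Pi.single_apply, apply_ite (Int.cast : ℤ → k)]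
  rw [map_sub, h, h]
  abel

end WindingLattice

section HookSymmetrizer

open Equiv WindingLattice

variable {s i : ℕ} (k : Type*) [Field k] (y : Fin (i + 1) ↪ Fin s)

open scoped Classical in
/-- The sum of the permutations that preserve the rows of a numbered hook, whose first column is
listed by `y` from the top: they fix the entries of this column below the corner. -/
noncomputable def hookRowSum : MonoidAlgebra k (Perm (Fin s)) :=
  ∑ p : Perm (Fin s) with ∀ r : Fin i, p (y r.succ) = y r.succ, MonoidAlgebra.of k _ p

open scoped Classical in
/-- The signed sum of the permutations that preserve the columns of a numbered hook, whose first
column is listed by `y`: they fix the entries outside this column. -/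
noncomputable def hookColSum : MonoidAlgebra k (Perm (Fin s)) :=
  ∑ q : Perm (Fin s) with ∀ a ∉ Set.range y, q a = a,
    ((Perm.sign q : ℤ) : k) • MonoidAlgebra.of k _ q

/-- The map from alternating forms on the winding lattice to the group algebra that identifies them
with the left ideal generated by the Young symmetrizer of a hook. -/
noncomputable def hookMap :
    (WindingLattice s [⋀^Fin i]→ₗ[ℤ] k) →ₗ[k] MonoidAlgebra k (Perm (Fin s)) :=
  LinearMap.mulRight k (hookColSum k y) ∘ₗ groupSum k _ ∘ₗ
    { toFun := fun ω g => ω fun r => gen (g (y r.succ))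
      map_add' := fun _ _ => rfl
      map_smul' := fun _ _ => rfl }

variable {k}

theorem hookMap_apply (ω : WindingLattice s [⋀^Fin i]→ₗ[ℤ] k) :
    hookMap k y ω = groupSum k _ (fun g => ω fun r => gen (g (y r.succ))) * hookColSum k y := rfl

/-- Multiplication by the column sum, for coefficients that come from an alternating form. -/
theorem groupSum_mul_hookColSum {V : Type*} [AddCommGroup V] (ω : V [⋀^Fin i]→ₗ[ℤ] k)
    (E : Fin s → V) :
    groupSum k _ (fun g => ω fun r => E (g (y r.succ))) * hookColSum k y =
      (i.factorial : k) • groupSum k _ fun g => ω fun r => E (g (y r.succ)) - E (g (y 0)) := by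
  classical
  rw [hookColSum, groupSum_mul_sum, ← map_smul]
  refine congrArg _ (funext fun g => ?_)
  rw [Perm.sum_filter_fixing_compl_range, ← Equiv.sum_comp (Equiv.inv _)]
  refine Eq.trans (Finset.sum_congr rfl fun τ _ => ?_)
    (ω.sum_sign_comp_succ fun j => E (g (y j)))
  rw [Perm.viaFintypeEmbedding_sign, Equiv.inv_apply, Perm.sign_inv]
  refine congrArg _ (congrArg ω (funext fun r => congrArg (fun b => E (g b)) ?_))
  rw [Perm.inv_eq_iff_eq, Perm.viaFintypeEmbedding_apply_image]
  exact congrArg y (τ.symm_apply_apply _).symm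

theorem hookMap_eq (ω : WindingLattice s [⋀^Fin i]→ₗ[ℤ] k) :
    hookMap k y ω = (i.factorial : k) • groupSum k _ fun g =>
      ω fun r => gen (g (y r.succ)) - gen (g (y 0)) :=
  groupSum_mul_hookColSum y ω gen

theorem hookMap_formRep (σ : Perm (Fin s)) (ω : WindingLattice s [⋀^Fin i]→ₗ[ℤ] k) :
    hookMap k y (formRep k s i σ ω) = MonoidAlgebra.of k _ σ * hookMap k y ω := by
  rw [hookMap_apply, hookMap_apply, ← mul_assoc, of_mul_groupSum]
  refine congrArg (fun f => groupSum k _ f * _) (funext fun g => congrArg ω (funext fun r => ?_))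
  exact perm_gen _ _

/-- A form in the kernel vanishes on all `(v₁ - v₀, …, vᵢ - v₀)` with the `v`s among the generators
of the lattice. Averaging over `v₀` shows that it vanishes on the generators, as these sum to
zero. -/
theorem hookMap_injective [CharZero k] : Function.Injective (hookMap k y) := by
  have hs : (s : k) ≠ 0 := Nat.cast_ne_zero.2 (Fin.pos (y 0)).ne'
  refine (injective_iff_map_eq_zero _).2 fun ω hω => ?_
  rw [hookMap_eq, smul_eq_zero_iff_right (Nat.cast_ne_zero.2 i.factorial_ne_zero),
    ← map_zero (groupSum k _)] at hω
  have h1 := groupSum_injective hω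
  have h2 : ∀ z : Fin (i + 1) → Fin s, (ω fun r => gen (z r.succ) - gen (z 0)) = 0 := by
    intro z
    by_cases hz : Function.Injective z
    · -- injective tuples are the translates of `y`; for the other ones, two arguments agree or
      -- one is zero
      obtain ⟨h, hh⟩ := Perm.exists_extending_pair y z y.injective hz
      have : (ω fun r => gen (h (y r.succ)) - gen (h (y 0))) = 0 := congrFun h1 h
      simpa only [hh] using this
    · obtain ⟨a, b, hab, hne⟩ : ∃ a b, z a = z b ∧ a ≠ b := by
        simpa [Function.Injective] using hz
      have h0 : ∀ c d : Fin i, z c.succ = z d.succ → c ≠ d →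
          (ω fun r => gen (z r.succ) - gen (z 0)) = 0 := fun c d h hcd =>
        ω.map_eq_zero_of_eq _ (i := c) (j := d) (by simp only [h]) hcd
      have h0' : ∀ c : Fin i, z c.succ = z 0 → (ω fun r => gen (z r.succ) - gen (z 0)) = 0 :=
        fun c h => ω.map_coord_zero c (by simp only [h, sub_self])
      induction a using Fin.cases with
      | zero =>
        induction b using Fin.cases with
        | zero => exact absurd rfl hne
        | succ d => exact h0' d hab.symm
      | succ c =>
        induction b using Fin.cases with
        | zero => exact h0' c hab
        | succ d => exact h0 c d hab fun h => hne (congrArg _ h)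
  refine form_ext fun w => ?_
  have h3 : ∀ a : Fin s, ω (fun r => gen (w r)) =
      ∑ q, ω (Function.update (fun r => gen (w r)) q (gen a)) := fun a => by
    have := h2 (Fin.cons a w)
    simp only [Fin.cons_succ, Fin.cons_zero] at this
    rw [ω.map_sub_const] at this
    exact sub_eq_zero.1 this
  have h4 : (s : k) * ω (fun r => gen (w r)) = 0 := by
    calc (s : k) * ω (fun r => gen (w r)) = ∑ _ : Fin s, ω (fun r => gen (w r)) := by simp
      _ = ∑ a, ∑ q, ω (Function.update (fun r => gen (w r)) q (gen a)) :=
        Finset.sum_congr rfl fun a _ => h3 a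
      _ = 0 := by
        rw [Finset.sum_comm]
        refine Finset.sum_eq_zero fun q _ => ?_
        rw [← ω.map_update_sum, sum_gen, ω.map_update_zero]
  exact (mul_eq_zero.1 h4).resolve_left hs

/-- The coefficients of a form only depend on the images of the column below the corner, so they are
invariant under the row permutations. -/
theorem hookMap_mem_leftIdeal [CharZero k] (ω : WindingLattice s [⋀^Fin i]→ₗ[ℤ] k) :
    hookMap k y ω ∈ leftIdeal (hookRowSum k y * hookColSum k y) := by
  classical
  let R : Finset (Perm (Fin s)) := {p | ∀ r : Fin i, p (y r.succ) = y r.succ}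
  have hR : (R.card : k) ≠ 0 := Nat.cast_ne_zero.2 <| Finset.card_ne_zero.2
    ⟨1, Finset.mem_filter.2 ⟨Finset.mem_univ _, fun _ => rfl⟩⟩
  have h : groupSum k _ (fun g => ω fun r => gen (g (y r.succ))) * hookRowSum k y =
      (R.card : k) • groupSum k _ (fun g => ω fun r => gen (g (y r.succ))) := by
    have h1 := groupSum_mul_sum (fun g => ω fun r => gen (g (y r.succ))) (fun _ => 1) R
    simp only [one_smul, one_mul] at h1
    have h2 : hookRowSum k y = ∑ p ∈ R, MonoidAlgebra.of k _ p := by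
      rw [hookRowSum]
    rw [h2, h1, ← map_smul]
    refine congrArg _ (funext fun g => ?_)
    rw [Finset.sum_congr rfl (g := fun _ => ω fun r => gen (g (y r.succ))), Finset.sum_const,
      nsmul_eq_mul]
    · rfl
    · intro p hp
      refine congrArg ω (funext fun r => congrArg gen (congrArg g ?_))
      rw [Perm.inv_eq_iff_eq, (Finset.mem_filter.1 hp).2]
  refine ⟨(R.card : k)⁻¹ • groupSum k _ (fun g => ω fun r => gen (g (y r.succ))), ?_⟩
  rw [LinearMap.mulRight_apply, ← mul_assoc, smul_mul_assoc, h, inv_smul_smul₀ hR, hookMap_apply]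

theorem hookRowSum_eq [DecidablePred fun p : Perm (Fin s) => ∀ r : Fin i, p (y r.succ) = y r.succ] :
    hookRowSum k y = groupSum k _ fun p =>
      if ∀ r : Fin i, p (y r.succ) = y r.succ then 1 else 0 := by
  rw [hookRowSum, groupSum_apply, Finset.sum_filter]
  refine Finset.sum_congr rfl fun p _ => ?_
  split_ifs <;> simp

/-- The column sum absorbs the permutations of the column, up to sign. -/
theorem of_mul_hookColSum {q : Perm (Fin s)} (hq : ∀ a ∉ Set.range y, q a = a) :
    MonoidAlgebra.of k _ q * hookColSum k y = ((Perm.sign q : ℤ) : k) • hookColSum k y := by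
  classical
  have h : hookColSum k y = groupSum k _ fun q =>
      if ∀ a ∉ Set.range y, q a = a then ((Perm.sign q : ℤ) : k) else 0 := by
    rw [hookColSum, groupSum_apply, Finset.sum_filter]
    refine Finset.sum_congr (by congr) fun p _ => ?_
    split_ifs <;> simp
  rw [h, of_mul_groupSum, ← map_smul]
  refine congrArg _ (funext fun g => ?_)
  have hiff : (∀ a ∉ Set.range y, (q⁻¹ * g) a = a) ↔ ∀ a ∉ Set.range y, g a = a :=
    forall₂_congr fun a ha => by rw [Perm.mul_apply, Perm.inv_eq_iff_eq, hq a ha, eq_comm]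
  simp only [hiff, Pi.smul_apply, smul_eq_mul, mul_ite, mul_zero, Perm.sign_mul, Perm.sign_inv,
    Units.val_mul, Int.cast_mul]

/-- The determinants of the rows of coordinates along the first column of the hook give a form
whose image is the Young symmetrizer, up to a factor. -/
theorem exists_hookMap_eq [CharZero k] :
    ∃ ω, hookMap k y ω = (i.factorial : k) • (hookRowSum k y * hookColSum k y) := by
  classical
  let ω₀ : (Fin s → k) [⋀^Fin i]→ₗ[k] k :=
    Matrix.detRowAlternating.compLinearMap (LinearMap.funLeft k k fun c : Fin i => y c.succ)
  refine ⟨AlternatingMap.pullbackInt (toCentered k s) ω₀, ?_⟩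
  have h1 := groupSum_mul_hookColSum y
    (AlternatingMap.pullbackInt (LinearMap.id : (Fin s → k) →ₗ[ℤ] (Fin s → k)) ω₀)
    fun a => Pi.single a 1
  rw [hookMap_eq]
  simp only [AlternatingMap.pullbackInt_apply, toCentered_gen_sub, LinearMap.id_apply] at h1 ⊢
  rw [← h1]
  let c : Fin i ↪ Fin s := (Fin.succEmb i).trans y
  have h2 : (groupSum k (Perm (Fin s)) fun g => ω₀ fun r => Pi.single (g (y r.succ)) 1) =
      ∑ π : Perm (Fin i), ((Perm.sign π : ℤ) : k) •
        (hookRowSum k y * MonoidAlgebra.of k _ (π.viaFintypeEmbedding c)⁻¹) := by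
    have h3 : ∀ π : Perm (Fin i),
        hookRowSum k y * MonoidAlgebra.of k _ (π.viaFintypeEmbedding c)⁻¹ =
          groupSum k _ fun g => if ∀ r : Fin i, g (y (π r).succ) = y r.succ then 1 else 0 := by
      intro π
      rw [hookRowSum_eq]
      have h4 := groupSum_mul_sum
        (fun p : Perm (Fin s) => if ∀ r : Fin i, p (y r.succ) = y r.succ then (1 : k) else 0)
        (fun _ => 1) {(π.viaFintypeEmbedding c)⁻¹}
      simp only [Finset.sum_singleton, one_smul, one_mul, inv_inv, Perm.mul_apply] at h4
      rw [h4]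
      refine congrArg _ (funext fun g => if_congr (forall_congr' fun r => ?_) rfl rfl)
      have := Perm.viaFintypeEmbedding_apply_image π c r
      rw [show y r.succ = c r from rfl, this]
      rfl
    simp_rw [h3, ← map_smul, ← map_sum]
    refine congrArg _ (funext fun g => ?_)
    rw [Finset.sum_apply]
    refine (Matrix.det_apply _).trans (Finset.sum_congr rfl fun π _ => ?_)
    rw [Pi.smul_apply, smul_eq_mul,  Units.smul_def, zsmul_eq_mul]
    refine congrArg _ (Eq.trans (Finset.prod_congr rfl
      (g := fun r => if g (y (π r).succ) = y r.succ then (1 : k) else 0) fun r _ => ?_)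
      (by simp only [Finset.prod_boole, Finset.mem_univ, true_implies]))
    change (Pi.single (g (y (π r).succ)) 1 : Fin s → k) (y r.succ) = _
    rw [Pi.single_apply]
    exact if_congr eq_comm rfl rfl
  rw [h2, Finset.sum_mul, Finset.sum_congr rfl fun π _ => ?_, Finset.sum_const, Finset.card_univ,
    Fintype.card_perm, Fintype.card_fin, ← Nat.cast_smul_eq_nsmul k]
  have hq : ∀ a ∉ Set.range y, (π.viaFintypeEmbedding c)⁻¹ a = a := fun a ha => by
    rw [Perm.inv_eq_iff_eq, Perm.viaFintypeEmbedding_apply_notMem_range]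
    rintro ⟨r, rfl⟩
    exact ha ⟨r.succ, rfl⟩
  rw [smul_mul_assoc, mul_assoc, of_mul_hookColSum y hq, mul_smul_comm, smul_smul, Perm.sign_inv,
    Perm.viaFintypeEmbedding_sign]
  rcases Int.units_eq_one_or (Perm.sign π) with h | h <;> simp [h]

theorem range_hookMap [CharZero k] :
    LinearMap.range (hookMap k y) = leftIdeal (hookRowSum k y * hookColSum k y) := by
  refine le_antisymm ?_ ?_
  · rintro _ ⟨ω, rfl⟩
    exact hookMap_mem_leftIdeal y ω
  · rintro _ ⟨x, rfl⟩
    obtain ⟨ω, hω⟩ := exists_hookMap_eq (k := k) y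
    rw [LinearMap.mulRight_apply]
    induction x using MonoidAlgebra.induction_on with
    | of σ =>
      refine ⟨(i.factorial : k)⁻¹ • formRep k s i σ ω, ?_⟩
      rw [map_smul, hookMap_formRep, hω, mul_smul_comm,
        inv_smul_smul₀ (Nat.cast_ne_zero.2 i.factorial_ne_zero)]
    | add x x' h h' => rw [add_mul]; exact add_mem h h'
    | smul c x h => rw [smul_mul_assoc]; exact Submodule.smul_mem _ c h

end HookSymmetrizer

/-! ### Young symmetrizers of hooks -/

section Hook

open Equiv WindingLattice

variable {s i : ℕ}

theorem mem_hookDiagram (h : i < s ∨ i = 0) {c : ℕ × ℕ} :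
    c ∈ hookDiagram s i h ↔ c.1 = 0 ∧ c.2 < s - i ∨ c.1 ≠ 0 ∧ c.1 ≤ i ∧ c.2 = 0 := by
  rw [hookDiagram, YoungDiagram.mem_ofRowLens]
  obtain ⟨a, b⟩ := c
  cases a with
  | zero => simp
  | succ a =>
    simp only [List.length_cons, List.length_replicate, List.getElem_cons_succ,
      List.getElem_replicate, exists_prop]
    omega

/-- The entries of the first column of a numbered hook, from the top. -/
def hookColumn (h : i < s) (T : Fin s ≃ (hookDiagram s i (Or.inl h)).cells) :
    Fin (i + 1) ↪ Fin s where
  toFun j := T.symm ⟨(j, 0), (mem_hookDiagram _).2 <| by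
    have := j.2
    rcases eq_or_ne (j : ℕ) 0 with h0 | h0
    · exact Or.inl ⟨h0, by simpa using h⟩
    · exact Or.inr ⟨h0, by simp only; omega, rfl⟩⟩
  inj' j j' hj := by
    simpa [Fin.val_inj] using T.symm.injective hj

theorem apply_hookColumn (h : i < s) (T : Fin s ≃ (hookDiagram s i (Or.inl h)).cells)
    (j : Fin (i + 1)) : (T (hookColumn h T j)).1 = ((j : ℕ), 0) :=
  congrArg Subtype.val (T.apply_symm_apply _)

theorem mem_range_hookColumn (h : i < s) (T : Fin s ≃ (hookDiagram s i (Or.inl h)).cells)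
    (a : Fin s) : a ∈ Set.range (hookColumn h T) ↔ (T a).1.2 = 0 := by
  refine ⟨?_, fun ha => ?_⟩
  · rintro ⟨j, rfl⟩
    rw [apply_hookColumn]
  · have h1 := (mem_hookDiagram _).1 (T a).2
    refine ⟨⟨(T a).1.1, by omega⟩, T.injective (Subtype.ext ?_)⟩
    rw [apply_hookColumn]
    exact Prod.ext rfl ha.symm

theorem preserves_col_iff (h : i < s) (T : Fin s ≃ (hookDiagram s i (Or.inl h)).cells)
    (q : Perm (Fin s)) : (∀ a, (T (q a)).1.2 = (T a).1.2) ↔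
      ∀ a ∉ Set.range (hookColumn h T), q a = a := by
  refine ⟨fun hq a ha => T.injective (Subtype.ext (Prod.ext ?_ (hq a))), fun hq a => ?_⟩
  · rw [mem_range_hookColumn] at ha
    have h1 := (mem_hookDiagram _).1 (T a).2
    have h2 := (mem_hookDiagram _).1 (T (q a)).2
    have h3 := hq a
    omega
  · by_cases ha : a ∈ Set.range (hookColumn h T)
    · have hb : q a ∈ Set.range (hookColumn h T) := by
        by_contra hb
        rw [q.injective (hq _ hb)] at hb
        exact hb ha
      rw [mem_range_hookColumn] at ha hb
      rw [ha, hb]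
    · rw [hq a ha]

theorem preserves_row_iff (h : i < s) (T : Fin s ≃ (hookDiagram s i (Or.inl h)).cells)
    (p : Perm (Fin s)) : (∀ a, (T (p a)).1.1 = (T a).1.1) ↔
      ∀ r : Fin i, p (hookColumn h T r.succ) = hookColumn h T r.succ := by
  refine ⟨fun hp r => T.injective (Subtype.ext (Prod.ext (hp _) ?_)), fun hp a => ?_⟩
  · have h1 := (mem_hookDiagram _).1 (T (p (hookColumn h T r.succ))).2
    have h3 := hp (hookColumn h T r.succ)
    rw [apply_hookColumn] at h3 ⊢
    simp only [Fin.val_succ] at h3 ⊢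
    omega
  · have key : ∀ a, (T a).1.1 ≠ 0 → p a = a := fun a ha => by
      have h1 := (mem_hookDiagram _).1 (T a).2
      obtain ⟨j, rfl⟩ := (mem_range_hookColumn h T a).2 (by omega)
      rw [apply_hookColumn] at ha
      obtain ⟨r, rfl⟩ := Fin.exists_succ_eq.2 (fun h0 : j = 0 => ha (by simp [h0]))
      exact hp r
    by_cases ha : (T a).1.1 = 0
    · by_contra hb
      rw [ha] at hb
      rw [p.injective (key _ hb)] at hb
      exact hb ha
    · rw [key a ha]

/-- Only the first row and the first column of a hook have more than one cell. -/
theorem youngSymmetrizer_hookDiagram (k : Type*) [Field k] (h : i < s)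
    (T : Fin s ≃ (hookDiagram s i (Or.inl h)).cells) :
    youngSymmetrizer k T = hookRowSum k (hookColumn h T) * hookColSum k (hookColumn h T) := by
  rw [youngSymmetrizer, hookRowSum, hookColSum]
  refine congrArg₂ _ (Finset.sum_congr (Finset.ext fun p => ?_) fun _ _ => rfl)
    (Finset.sum_congr (Finset.ext fun q => ?_) fun _ _ => rfl)
  · simp only [Finset.mem_filter, preserves_row_iff h T p]
  · simp only [Finset.mem_filter, preserves_col_iff h T q]

/-- The alternating `i`-forms on the winding lattice are the irreducible representation attached to
the hook with `i` cells below the corner. -/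
theorem nonempty_formRep_equiv_spechtRep (k : Type*) [Field k] [CharZero k] (h : i < s ∨ i = 0) :
    Nonempty ((formRep k s i).Equiv
      (spechtRep k (hookDiagram s i h) (card_hookDiagram s i h))) := by
  by_cases hi : i < s
  · let T := numbering (hookDiagram s i h) (card_hookDiagram s i h)
    let y := hookColumn hi T
    have hr : LinearMap.range (hookMap k y) = leftIdeal (youngSymmetrizer k T) := by
      rw [range_hookMap, youngSymmetrizer_hookDiagram]
    exact ⟨.mk ((LinearEquiv.ofInjective (hookMap k y) (hookMap_injective y)).trans
      (LinearEquiv.ofEq _ _ hr)) fun g => LinearMap.ext fun ω => Subtype.ext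
        (hookMap_formRep y g ω)⟩
  · obtain rfl : i = 0 := by omega
    obtain rfl : s = 0 := by omega
    have h1 : leftIdeal (youngSymmetrizer k
        (numbering (hookDiagram 0 0 h) (card_hookDiagram 0 0 h))) = ⊤ := by
      have hc : youngSymmetrizer k
          (numbering (hookDiagram 0 0 h) (card_hookDiagram 0 0 h)) = 1 := by
        simp [youngSymmetrizer, MonoidAlgebra.one_def]
      rw [hc, leftIdeal, LinearMap.mulRight_one, LinearMap.range_id]
    let e1 : (WindingLattice 0 [⋀^Fin 0]→ₗ[ℤ] k) ≃ₗ[k] k :=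
      { toFun := fun ω => ω 0
        invFun := fun c => AlternatingMap.constOfIsEmpty ℤ _ _ c
        map_add' := fun _ _ => rfl
        map_smul' := fun _ _ => rfl
        left_inv := fun ω => by ext v; rw [Subsingleton.elim v 0]; rfl
        right_inv := fun c => rfl }
    let e2 : MonoidAlgebra k (Perm (Fin 0)) ≃ₗ[k] k :=
      (MonoidAlgebra.basis (Perm (Fin 0)) k).equivFun.trans (LinearEquiv.funUnique _ k k)
    exact ⟨.mk (e1.trans (e2.symm.trans ((LinearEquiv.ofTop _ h1).symm))) fun g => by
      rw [Subsingleton.elim g 1, map_one, map_one]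
      rfl⟩

/-- In the top degree, the symmetric group acts on alternating forms by the sign. -/
theorem formRep_eq_sign_smul {k : Type*} [Field k] [CharZero k] (σ : Perm (Fin (i + 1)))
    (ω : WindingLattice (i + 1) [⋀^Fin i]→ₗ[ℤ] k) :
    formRep k (i + 1) i σ ω = ((Perm.sign σ : ℤ) : k) • ω := by
  let y := Function.Embedding.refl (Fin (i + 1))
  have hy : ∀ q : Perm (Fin (i + 1)), ∀ a ∉ Set.range y, q a = a :=
    fun q a ha => absurd ⟨a, rfl⟩ ha
  obtain ⟨c, hc⟩ : ∃ c : k, hookMap k y ω = c • hookColSum k y := by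
    refine ⟨∑ g : Perm (Fin (i + 1)), (ω fun r => gen (g (y r.succ))) * ((Perm.sign g : ℤ) : k), ?_⟩
    rw [hookMap_apply, groupSum_apply, Finset.sum_mul]
    simp only [smul_mul_assoc, of_mul_hookColSum y (hy _), smul_smul]
    rw [← Finset.sum_smul]
  refine hookMap_injective y ?_
  rw [hookMap_formRep, map_smul, hc, mul_smul_comm, of_mul_hookColSum y (hy σ), smul_comm]

end Hook

/-! ### The mapping class group of the marked circle -/

section MarkedCircle

universe u

open WindingLattice

variable {s : ℕ} {x : Fin s → Circle}

/-- The winding lattice is free of rank `s - 1`: the coordinates are the differences with the first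
winding number. -/
theorem WindingLattice.nonempty_equiv (s : ℕ) :
    Nonempty (WindingLattice s ≃ₗ[ℤ] (Fin (s - 1) → ℤ)) := by
  cases s with
  | zero =>
    exact ⟨LinearEquiv.ofBijective 0 ⟨fun a b _ => Subsingleton.elim a b,
      fun b => ⟨0, Subsingleton.elim (α := Fin 0 → ℤ) _ _⟩⟩⟩
  | succ n =>
    let f : (Fin (n + 1) → ℤ) →ₗ[ℤ] (Fin n → ℤ) :=
      { toFun := fun v j => v j.succ - v 0
        map_add' := fun v w => funext fun j => by simp only [Pi.add_apply]; ring
        map_smul' := fun c v => funext fun j => by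
          simp only [Pi.smul_apply, smul_eq_mul, RingHom.id_apply]; ring }
    refine ⟨(Submodule.quotEquivOfEq _ _ ?_).trans (f.quotKerEquivOfSurjective fun w => ?_)⟩
    · ext v
      rw [Submodule.mem_span_singleton, LinearMap.mem_ker]
      constructor
      · rintro ⟨c, rfl⟩
        funext j
        simp [f]
      · intro hv
        refine ⟨v 0, funext fun j => ?_⟩
        induction j using Fin.cases with
        | zero => simp
        | succ j =>
          have := congrFun hv j
          simp only [f, LinearMap.coe_mk, AddHom.coe_mk, Pi.zero_apply] at this
          simp only [Pi.smul_apply, Pi.one_apply, smul_eq_mul, mul_one]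
          omega
    · exact ⟨Fin.cons 0 w, funext fun j => by simp [f]⟩

theorem MCG.windingNumbers_mul (g h : MCG x) :
    windingNumbers ((g : ExtMCG x) * (h : ExtMCG x)) =
      windingNumbers (g : ExtMCG x) + degHom x g • windingNumbers (h : ExtMCG x) := by
  rw [_root_.windingNumbers_mul, MonoidHom.mem_ker.1 h.2, inv_one, map_one]
  rfl

/-- A class of degree `1` fixing the marked points, with the given winding numbers. -/
noncomputable def MCG.ofWinding (hx : Function.Injective x) (l : WindingLattice s) : MCG x :=
  ⟨(ExtMCG.exists_eq hx 1 1 l).choose, (ExtMCG.exists_eq hx 1 1 l).choose_spec.1⟩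

theorem MCG.ofWinding_spec (hx : Function.Injective x) (l : WindingLattice s) :
    degHom x (MCG.ofWinding hx l) = 1 ∧ windingNumbers (MCG.ofWinding hx l : ExtMCG x) = l :=
  (ExtMCG.exists_eq hx 1 1 l).choose_spec.2

theorem MCG.eq_ofWinding (hx : Function.Injective x) {g : ExtMCG x} {l : WindingLattice s}
    (h1 : permHom x g = 1) (h2 : degHom x g = 1) (h3 : windingNumbers g = l) :
    g = MCG.ofWinding hx l :=
  ExtMCG.ext (h1.trans (MonoidHom.mem_ker.1 (MCG.ofWinding hx l).2).symm)
    (h2.trans (MCG.ofWinding_spec hx l).1.symm) (h3.trans (MCG.ofWinding_spec hx l).2.symm)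

/-- The group of classes fixing the marked points is the generalized dihedral group of the winding
lattice: the degree and the winding numbers are the two components of a class. -/
noncomputable def MCG.generalizedDihedral (hx : Function.Injective x) :
    GeneralizedDihedral (ULift.{u} (MCG x)) (WindingLattice s) where
  sgn := (degHom x).comp ((MCG x).subtype.comp
    (MulEquiv.ulift : ULift.{u} (MCG x) ≃* MCG x).toMonoidHom)
  trans g := windingNumbers (g.down : ExtMCG x)
  trans_mul g h := MCG.windingNumbers_mul g.down h.down
  incl l := ⟨MCG.ofWinding hx l⟩
  trans_incl l := (MCG.ofWinding_spec hx l).2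
  sgn_incl l := (MCG.ofWinding_spec hx l).1
  incl_trans g hg := ULift.ext _ _ (Subtype.ext
    (MCG.eq_ofWinding hx (MonoidHom.mem_ker.1 g.down.2) hg rfl).symm)
  reflection := ⟨(ExtMCG.exists_eq hx 1 (-1) 0).choose,
    (ExtMCG.exists_eq hx 1 (-1) 0).choose_spec.1⟩
  sgn_reflection := (ExtMCG.exists_eq hx 1 (-1) 0).choose_spec.2.1

/-- Conjugation by a class acts on the lattice by permuting the coordinates, up to the sign given by
the degree. -/
theorem MCG.conjHom_incl (hx : Function.Injective x) (u : ExtMCG x) (l : WindingLattice s) :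
    conjHom.{u} u ((MCG.generalizedDihedral hx).incl l) =
      (MCG.generalizedDihedral hx).incl (((degHom x u : ℤˣ) : ℤ) • perm s (permHom x u) l) := by
  refine ULift.ext _ _ (Subtype.ext ?_)
  have hg : permHom x (MCG.ofWinding hx l : ExtMCG x) = 1 :=
    MonoidHom.mem_ker.1 (MCG.ofWinding hx l).2
  obtain ⟨hd, hw⟩ := MCG.ofWinding_spec hx l
  change u * (MCG.ofWinding hx l : ExtMCG x) * u⁻¹ = (MCG.ofWinding hx _ : MCG x)
  set g : ExtMCG x := (MCG.ofWinding hx l).1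
  have hp : permHom x (u * g * u⁻¹) = 1 := by
    rw [map_mul, map_mul, hg, mul_one, map_inv, mul_inv_cancel]
  have hd' : degHom x (u * g * u⁻¹) = 1 := by
    rw [map_mul, map_mul, hd, mul_one, map_inv, mul_inv_cancel]
  refine MCG.eq_ofWinding hx hp hd' ?_
  -- both sides of `(u g u⁻¹) u = u g` have the same winding numbers
  have h1 := _root_.windingNumbers_mul (u * g * u⁻¹) u
  rw [inv_mul_cancel_right, _root_.windingNumbers_mul, hg, hd', one_smul, inv_one, map_one,
    Module.End.one_apply, add_comm, add_right_cancel_iff, hw] at h1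
  have h2 := congrArg (perm s (permHom x u)) h1
  rw [← Module.End.mul_apply, ← map_mul, mul_inv_cancel, map_one, Module.End.one_apply] at h2
  rw [← h2]
  exact map_zsmul _ _ _

/-- In even degrees, the identification of the cohomology with alternating forms on the winding
lattice turns the conjugation action into the permutation of coordinates. -/
theorem conjAction_formEquiv (k : Type u) [Field k] [CharZero k] (hx : Function.Injective x)
    (e : WindingLattice s ≃ₗ[ℤ] (Fin (s - 1) → ℤ)) {i : ℕ} (hi : Even i) (u : ExtMCG x)
    (ω : WindingLattice s [⋀^Fin i]→ₗ[ℤ] k) :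
    conjAction k i u ((MCG.generalizedDihedral hx).formEquiv k e hi ω) =
      (MCG.generalizedDihedral hx).formEquiv k e hi (formRep k s i (permHom x u) ω) := by
  refine ((MCG.generalizedDihedral hx).map_formEquiv k e hi (conjHom u⁻¹) _ (fun _ => rfl)
    (((degHom x u⁻¹ : ℤˣ) : ℤ) • perm s (permHom x u⁻¹)) (MCG.conjHom_incl hx u⁻¹) ω).trans
    (congrArg _ ?_)
  ext v
  rw [formRep_apply, map_inv (permHom x)]
  -- the degree enters through its `i`-th power, which is `1` as `i` is even
  change (ω fun r => ((degHom x u⁻¹ : ℤˣ) : ℤ) • perm s (permHom x u)⁻¹ (v r)) =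
    ω fun r => perm s (permHom x u)⁻¹ (v r)
  rw [ω.map_smul_univ (fun _ => ((degHom x u⁻¹ : ℤˣ) : ℤ)), Finset.prod_const, Finset.card_univ,
    Fintype.card_fin]
  rcases Int.units_eq_one_or (degHom x u⁻¹) with h | h <;> simp [h, hi.neg_one_pow]

end MarkedCircle

theorem mainTheorem2 (k : Type*) [Field k] [CharZero k] (s : ℕ) (x : Fin s → Circle)
    (hx : Function.Injective x) :
    (∀ f : MarkedMap x, f.IsHomotopyEquiv → IsUnit (f : (MarkedMap.homotopyCon x).Quotient)) ∧
    Function.Surjective (permHom x) ∧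
    ∀ i : ℕ, ∃ ρ : Representation k (Equiv.Perm (Fin s)) (MCGCohomology k x i),
      IsInducedAction k ρ ∧
      (Even i → ∀ h : i < s ∨ i = 0,
        Nonempty (ρ.Equiv (spechtRep k (hookDiagram s i h) (card_hookDiagram s i h)))) ∧
      (Even i → s ≤ i → i ≠ 0 → Subsingleton (MCGCohomology k x i)) ∧
      (Odd i → Subsingleton (MCGCohomology k x i)) ∧
      (∀ m : ℕ, s = 2 * m + 1 → i = 2 * m →
        Module.finrank k (MCGCohomology k x i) = 1 ∧
        ∀ (σ : Equiv.Perm (Fin s)) (v : MCGCohomology k x i),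
          ρ σ v = ((Equiv.Perm.sign σ : ℤ) : k) • v) := by
  refine ⟨fun f hf => (MarkedMap.isUnit_coe_iff hx f).2 (f.isUnit_degree hf), fun σ =>
    (ExtMCG.exists_eq hx σ 1 0).imp fun u hu => hu.1, fun i => ?_⟩
  obtain ⟨e⟩ := WindingLattice.nonempty_equiv s
  let D := MCG.generalizedDihedral hx
  rcases Nat.even_or_odd i with hi | hi
  · let E := D.formEquiv k e hi
    obtain ⟨hfin, hrank⟩ := D.finrank_of_even k e hi
    let ρ : Representation k (Equiv.Perm (Fin s)) (MCGCohomology k x i) :=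
      (E.conjRingEquiv : _ →* _).comp (WindingLattice.formRep k s i)
    have hρ : ∀ σ ω, ρ σ (E ω) = E (WindingLattice.formRep k s i σ ω) := fun σ ω =>
      congrArg (fun ω => E (WindingLattice.formRep k s i σ ω)) (E.symm_apply_apply ω)
    refine ⟨ρ, fun u => ?_, fun _ h => ?_, fun _ hs h0 => ?_, fun ho => ?_, ?_⟩
    · refine LinearMap.ext fun v => ?_
      obtain ⟨ω, rfl⟩ := E.surjective v
      rw [hρ]
      exact (conjAction_formEquiv k hx e hi u ω).symm
    · obtain ⟨φ⟩ := nonempty_formRep_equiv_spechtRep (i := i) k h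
      exact ⟨Representation.Equiv.trans (Representation.Equiv.mk E.symm fun σ =>
        LinearMap.ext fun v => E.symm_apply_apply _) φ⟩
    · refine Module.finrank_zero_iff.1 (hrank.trans (Nat.choose_eq_zero_of_lt (by omega)))
    · exact absurd hi (Nat.not_even_iff_odd.2 ho)
    · rintro m rfl rfl
      refine ⟨hrank.trans (by simp), fun σ v => ?_⟩
      obtain ⟨ω, rfl⟩ := E.surjective v
      rw [hρ, formRep_eq_sign_smul, map_smul]
  · have hsub : Subsingleton (MCGCohomology k x i) := D.subsingleton_of_odd k e hi
    refine ⟨1, fun u => LinearMap.ext fun v => Subsingleton.elim _ _, fun he => ?_,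
      fun _ _ _ => hsub, fun _ => hsub, fun m _ hm => ?_⟩
    · exact absurd he (Nat.not_even_iff_odd.2 hi)
    · exact absurd ⟨m, by omega⟩ (Nat.not_even_iff_odd.2 hi)
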